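/- Consider a wiretap channel with an $m$-antenna transmitter, a legitimate receiver $\mathrm{Rx}_1$ with $n_1$ antennas and $k\ge 1$ eavesdroppers $\mathrm{Rx}_2,\dots,\mathrm{Rx}_{k+1}$ with $n_2,\dots,n_{k+1}$ antennas, all $n_j\ge 1$. At time $t$ receiver $j$ observes $\vec y_j(t)=g_j(t)\vec x(t)+\vec z_j(t)\in\mathbb C^{n_j}$, where the entries of all $\vec z_j(t)$ are i.i.d. $\mathcal{CN}(0,1)$ and, independently, the entries of all channel matrices $g_j(t)\in\mathbb C^{n_j\times m}$ are i.i.d. over antennas, receivers and time, bounded in absolute value by a constant $d_{\max}$, with a density on $\mathbb C$ that is at most $f_{\max}(p)$, where $f_{\max}(p)=o(\log p)$ as $p\to\infty$ (the law may depend on the power $p$). Let $\mathcal G^n$ be the collection of all channel matrices at times $1,\dots,n$. An encoding strategy of block length $n$ consists of maps $\vec x(t)=f_t^{(n)}(W,U,g_1(1),\dots,g_1(t-1))$, $1\le t\le n$, where $W$ is uniform on a finite message set and $U$ is private randomness of the transmitter (possibly trivial), with $W$, $U$, the channels and the noise independent; thus the transmitter has delayed channel knowledge about $\mathrm{Rx}_1$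 and none about the eavesdroppers. It has power at most $p$ if $\frac1n E\|\vec x^n\|^2\le p$. Put $n_{\max}=\max(n_2,\dots,n_{k+1})$ and $\bar n=\min(n_1,n_{\max})$, let $\mathrm{Rx}_{\max}$ be an eavesdropper with $n_{\max}$ antennas, and let $\vec y_{\max,1}^n$ be the signal received by its first $\bar n$ antennas at times $1,\dots,n$. Let $h(\cdot\mid\mathcal G^n)$ denote conditional differential entropy. If $m>\max(n_1,n_{\max})$, then there is a function $\varepsilon(p)=o(\log p)$ as $p\to\infty$, depending only on $m$, the numbers of antennas of the receivers, $d_{\max}$ and the function $f_{\max}$, such that for every $p>0$, every admissible channel law, every $n\ge1$ and every encoding strategy of block length $n$ and power at most $p$, both conditional entropies below exist and are finite, and $$h(\vec y_1^n\mid\mathcal G^n)\;\le\;\frac{n_1}{\bar n}\,h(\vec y_{\max,1}^n\mid\mathcal G^n)+n\,\varepsilon(p).$$ -/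

import Mathlib

open MeasureTheory ProbabilityTheory
open scoped ENNReal NNReal

/-! Conditional differential entropy. -/

namespace Wiretap

section Entropy

variable {Ω S E : Type*} [MeasurableSpace Ω] [MeasurableSpace S] [MeasureSpace E]

/-- The conditional density `f(y | g)`: the Radon-Nikodym derivative of the joint law of `(G, Y)`
with respect to (law of `G`) ⊗ (Lebesgue measure). -/
noncomputable def condDensity (μ : Measure Ω) (Y : Ω → E) (G : Ω → S) : S × E → ℝ≥0∞ :=
  (μ.map fun ω => (G ω, Y ω)).rnDeriv ((μ.map G).prod volume)

/-- The conditional differential entropy `h(Y | G) = - E [log f(Y | G)]`, in nats. -/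
noncomputable def condDiffEntropy (μ : Measure Ω) (Y : Ω → E) (G : Ω → S) : ℝ :=
  - ∫ ω, Real.log (condDensity μ Y G (G ω, Y ω)).toReal ∂μ

/-- `h(Y | G)` is a genuine finite number: the conditional density exists and `log f(Y | G)` is
integrable. -/
def HasCondDiffEntropy (μ : Measure Ω) (Y : Ω → E) (G : Ω → S) : Prop :=
  (μ.map fun ω => (G ω, Y ω)) ≪ (μ.map G).prod volume ∧
    Integrable (fun ω => Real.log (condDensity μ Y G (G ω, Y ω)).toReal) μ

end Entropy

/-! The channel.  There are `k + 1` receivers; receiver `0` is the legitimate one, and the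
receivers `i.succ`, `i : Fin k`, are the eavesdroppers.  Receiver `j` has `N j` antennas, and the
transmitter has `m` antennas. -/

/-- The circularly symmetric complex Gaussian law `CN(0, 1)`: real and imaginary part are
independent and `N(0, 1/2)`. -/
noncomputable def complexGaussian : Measure ℂ :=
  ((gaussianReal 0 (1 / 2)).prod (gaussianReal 0 (1 / 2))).map fun q : ℝ × ℝ => (⟨q.1, q.2⟩ : ℂ)

/-- An admissible law of one channel coefficient: a probability measure on `ℂ` that is carried by
the disc of radius `dmax` and has a density with values at most `F`. -/
structure IsChannelLaw (dmax F : ℝ) (law : Measure ℂ) : Prop where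
  isProbabilityMeasure : IsProbabilityMeasure law
  bounded : ∀ᵐ z ∂law, ‖z‖ ≤ dmax
  density : ∃ f : ℂ → ℝ≥0∞, Measurable f ∧ law = volume.withDensity f ∧
    ∀ z, f z ≤ ENNReal.ofReal F

/-- The maximal number of antennas of an eavesdropper. -/
def nMax {k : ℕ} (N : Fin (k + 1) → ℕ) : ℕ :=
  Finset.univ.sup fun i : Fin k => N i.succ

/-- `min (n₁, n_max)`. -/
def nBar {k : ℕ} (N : Fin (k + 1) → ℕ) : ℕ :=
  min (N 0) (nMax N)

/-- All channel coefficients over `n` time slots: `g t j r i` is the coefficient at time `t` from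
transmit antenna `i` to antenna `r` of receiver `j`. -/
abbrev Channels {k : ℕ} (m : ℕ) (N : Fin (k + 1) → ℕ) (n : ℕ) : Type :=
  Fin n → (j : Fin (k + 1)) → Fin (N j) → Fin m → ℂ

/-- All noise samples over `n` time slots. -/
abbrev Noises {k : ℕ} (N : Fin (k + 1) → ℕ) (n : ℕ) : Type :=
  Fin n → (j : Fin (k + 1)) → Fin (N j) → ℂ

/-- The channel coefficients are i.i.d. over time, receivers and antennas. -/
noncomputable def channelMeasure {k : ℕ} (m : ℕ) (N : Fin (k + 1) → ℕ) (n : ℕ)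
    (law : Measure ℂ) : Measure (Channels m N n) :=
  Measure.pi fun _ => Measure.pi fun _ => Measure.pi fun _ => Measure.pi fun _ => law

/-- The noise samples are i.i.d. `CN(0, 1)`. -/
noncomputable def noiseMeasure {k : ℕ} (N : Fin (k + 1) → ℕ) (n : ℕ) : Measure (Noises N n) :=
  Measure.pi fun _ => Measure.pi fun _ => Measure.pi fun _ => complexGaussian

/-- An encoding strategy of block length `n` with delayed CSIT from receiver `0` and no CSIT from
the eavesdroppers.  At time `t` the transmitted vector is a function of the message, of the
channel matrices of receiver `0` at the times before `t`, and of private randomness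
of the transmitter (artificial noise), which is independent of everything else.  Deterministic
encoders are those with a one-point space `Priv`. -/
structure Encoder {k : ℕ} (m : ℕ) (N : Fin (k + 1) → ℕ) (n : ℕ) where
  /-- the number of messages -/
  M : ℕ
  M_pos : 0 < M
  /-- the space in which the private randomness takes its values -/
  Priv : Type
  [measPriv : MeasurableSpace Priv]
  /-- the law of the private randomness -/
  privLaw : Measure Priv
  [probPriv : IsProbabilityMeasure privLaw]
  /-- the encoding functions `f_t` -/
  enc : (t : Fin n) → Fin M → Priv → (Fin (t : ℕ) → Fin (N 0) → Fin m → ℂ) → Fin m → ℂ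
  measurable_enc : ∀ (t : Fin n) (w : Fin M),
    Measurable fun q : Priv × (Fin (t : ℕ) → Fin (N 0) → Fin m → ℂ) => enc t w q.1 q.2

attribute [instance] Encoder.measPriv Encoder.probPriv

namespace Encoder

variable {k m n : ℕ} {N : Fin (k + 1) → ℕ} (c : Encoder m N n)

/-- Sample space: message, private randomness, channel coefficients, noise. -/
abbrev Sample : Type :=
  Fin c.M × c.Priv × Channels m N n × Noises N n

/-- The joint law: the message is uniform, and message, private randomness, channel coefficients
and noise are independent. -/
noncomputable def measure (law : Measure ℂ) : Measure c.Sample :=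
  (uniformOn (Set.univ : Set (Fin c.M))).prod
    (c.privLaw.prod ((channelMeasure m N n law).prod (noiseMeasure N n)))

/-- The collection of all channel coefficients over the block. -/
def G (ω : c.Sample) : Channels m N n := ω.2.2.1

/-- The transmitted vector at time `t`. -/
def X (ω : c.Sample) (t : Fin n) : Fin m → ℂ :=
  c.enc t ω.1 ω.2.1 fun s => c.G ω (Fin.castLE t.isLt.le s) 0

/-- The block received by receiver `j`: `y_j(t) = g_j(t) x(t) + z_j(t)`. -/
def Y (j : Fin (k + 1)) (ω : c.Sample) : Fin n → Fin (N j) → ℂ :=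
  fun t r => (∑ i, c.G ω t j r i * c.X ω t i) + ω.2.2.2 t j r

/-- The block received by the first `a` antennas of receiver `j`. -/
def YFirst (j : Fin (k + 1)) (a : ℕ) (ha : a ≤ N j) (ω : c.Sample) : Fin n → Fin a → ℂ :=
  fun t r => c.Y j ω t (Fin.castLE ha r)

/-- The average power constraint `(1 / n) E ‖x^n‖² ≤ p`. -/
def PowerConstraint (law : Measure ℂ) (p : ℝ) : Prop :=
  ∫⁻ ω, ∑ t, ∑ i, ‖c.X ω t i‖ₑ ^ 2 ∂(c.measure law) ≤ (n : ℝ≥0∞) * ENNReal.ofReal p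

end Encoder

/-- The smaller of `n₁` and `n_max` is at most the number of antennas of a strongest
eavesdropper. -/
theorem nBar_le {k : ℕ} {N : Fin (k + 1) → ℕ} {e : Fin k} (he : N e.succ = nMax N) :
    nBar N ≤ N e.succ :=
  he ▸ min_le_right _ _

end Wiretap

/-! The comparison of the two entropies.  Given the channels, the density of the output of a
receiver whose channel the transmitter does not know is bounded, in the logarithmic mean, by the
mean over an independent codeword of a product of heavy-tailed kernels of the differences of the
inputs (`Encoder.lintegral_alignmentRatio_le`).  The Jensen inequality adjusts the number of
antennas (`mul_log_spread_le`), the same kernels evaluated at the differences of the outputs of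
receiver `0` dominate them (`log_spread_le`), and these have, after multiplication by a slowly
decaying weight, a total mass that is logarithmic in the power (`lintegral_tailRatio_le`). -/

namespace Wiretap

/-! Integrals over finite products. -/

section Pi

variable {α : Type*} [MeasurableSpace α]

/-! Given the channels, the density of a received block, evaluated at that block, is a mean over an
independent source `s'`: the Gaussian density at the difference of the noiseless outputs of `s` and
`s'`, plus noise. So `-h` measures how strongly the codeword sent is aligned with an independent
one, and the theorem says that alignment at the eavesdropper forces alignment at receiver `0`.

Eavesdropper. The inputs depend on the channel of receiver `0` only, so the eavesdropper's rows are
independent of the difference `d` of two inputs. A row with bounded coefficient density lets `d t`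
disappear in the noise with mean density at most `(1 + F) / (1 + ‖d t‖ ^ 2)`. Over `a` antennas this
is an `a`-th power, and its mean over `s'` is `spread`. The ratio of the true density to `spread`
has mean at most `1` (`Encoder.lintegral_alignmentRatio_le`), so by `log x ≤ log y + x / y - 1` the
mean logarithm of the density is at most that of `spread`.

Number of antennas. The factor `n₁ / a` is Jensen's inequality for powers: the `a`-th moment raised
to the power `b / a` is at most the `b`-th moment if `a ≤ b` (`mul_log_spread_le`).

Receiver `0`. Its channel may be correlated with the inputs, so only boundedness of the coefficients
is used: output differences are at most a constant times input differences, whence `1 / (1 + ‖d t‖ ^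
2)` is at most a constant, times a function of the noise, times the same kernel of the output
difference (`log_spread_le`). This kernel just fails to be integrable on `ℂ`. The weight `(1 + |y| ^
2) ^ (-δ)` repairs that with mass `2 * π / δ` per coordinate, and comparing the normalised product
with the true density (`log_tailDensity_le`, `lintegral_tailRatio_le`) costs `log (2 * π / δ)` plus
`δ` times the mean of `log (1 + |y| ^ 2)` per coordinate. With `δ = 1 / log P` and `P` of the order
of the power, the first is of order `log log p` and the second is bounded. The remaining loss `log
(1 + F) ≤ F` is `o(log p)` by hypothesis. -/

theorem lintegral_pi_prod {n : ℕ} (μ : Measure α) [SigmaFinite μ] (f : Fin n → α → ℝ≥0∞)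
    (hf : ∀ i, Measurable (f i)) :
    ∫⁻ x, ∏ i, f i (x i) ∂(Measure.pi fun _ : Fin n => μ) = ∏ i, ∫⁻ x, f i x ∂μ := by
  induction n with
  | zero => simp
  | succ n ih =>
    have h := (measurePreserving_piFinSuccAbove (fun _ : Fin (n + 1) => μ) 0).symm
    have hm : Measurable fun x : Fin (n + 1) → α => ∏ i, f i (x i) :=
      Finset.measurable_prod _ fun i _ => (hf i).comp (measurable_pi_apply i)
    rw [← h.lintegral_comp hm]
    simp only [Fin.prod_univ_succ, MeasurableEquiv.piFinSuccAbove_symm_apply,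
      Fin.insertNthEquiv_apply, Fin.insertNth_zero, Fin.cons_zero, Fin.cons_succ]
    have hm' : Measurable fun x : Fin n → α => ∏ i, f i.succ (x i) :=
      Finset.measurable_prod _ fun i _ => (hf i.succ).comp (measurable_pi_apply i)
    rw [← ih _ fun i => hf i.succ]
    exact lintegral_prod_mul (hf 0).aemeasurable hm'.aemeasurable

theorem pi_withDensity {n : ℕ} (μ : Measure α) [SigmaFinite μ] (f : α → ℝ≥0∞) (hf : Measurable f)
    [SigmaFinite (μ.withDensity f)] :
    (Measure.pi fun _ : Fin n => μ.withDensity f) =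
      (Measure.pi fun _ : Fin n => μ).withDensity fun x => ∏ i, f (x i) := by
  refine Measure.pi_eq fun s hs => ?_
  rw [withDensity_apply _ (MeasurableSet.univ_pi hs), ← lintegral_indicator (MeasurableSet.univ_pi hs)]
  have : (Set.univ.pi s).indicator (fun x : Fin n → α => ∏ i, f (x i)) =
      fun x => ∏ i, (s i).indicator f (x i) := by
    ext x
    by_cases hx : x ∈ Set.univ.pi s
    · rw [Set.indicator_of_mem hx]
      exact Finset.prod_congr rfl fun i _ => (Set.indicator_of_mem (hx i trivial) f).symm
    · rw [Set.indicator_of_notMem hx]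
      simp only [Set.mem_pi, Set.mem_univ, true_implies, not_forall] at hx
      obtain ⟨i, hi⟩ := hx
      exact (Finset.prod_eq_zero (Finset.mem_univ i) (Set.indicator_of_notMem hi f)).symm
  rw [this, lintegral_pi_prod μ _ fun i => hf.indicator (hs i)]
  exact Finset.prod_congr rfl fun i _ => by
    rw [lintegral_indicator (hs i), withDensity_apply _ (hs i)]

end Pi

/-! The complex Gaussian law. -/

/-- The density of `CN(0, 1)`. -/
noncomputable def gaussDensity (u : ℂ) : ℝ :=
  Real.pi⁻¹ * Real.exp (-‖u‖ ^ 2)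

theorem gaussDensity_pos (u : ℂ) : 0 < gaussDensity u := by
  unfold gaussDensity; positivity

theorem gaussDensity_le_one (u : ℂ) : gaussDensity u ≤ 1 := by
  unfold gaussDensity
  have h1 : Real.pi⁻¹ ≤ 1 := inv_le_one_of_one_le₀ (by linarith [Real.pi_gt_three])
  have h2 : Real.exp (-‖u‖ ^ 2) ≤ 1 := Real.exp_le_one_iff.2 (by nlinarith [sq_nonneg ‖u‖])
  exact mul_le_one₀ h1 (Real.exp_pos _).le h2

@[fun_prop]
theorem measurable_gaussDensity : Measurable gaussDensity := by
  unfold gaussDensity; fun_prop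

theorem complexGaussian_eq_withDensity :
    complexGaussian = volume.withDensity fun u => ENNReal.ofReal (gaussDensity u) := by
  have hv : (1 / 2 : ℝ≥0) ≠ 0 := by norm_num
  have : SFinite (volume.withDensity (gaussianPDF 0 (1 / 2))) := by
    rw [← gaussianReal_of_var_ne_zero 0 hv]; infer_instance
  have hdens : ∀ q : ℝ × ℝ, gaussianPDF 0 (1 / 2) q.1 * gaussianPDF 0 (1 / 2) q.2 =
      ENNReal.ofReal (gaussDensity ⟨q.1, q.2⟩) := by
    intro q
    rw [gaussianPDF, gaussianPDF, ← ENNReal.ofReal_mul (gaussianPDFReal_nonneg _ _ _)]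
    congr 1
    simp only [gaussianPDFReal, gaussDensity, Complex.sq_norm, Complex.normSq_mk]
    have h2 : (2 : ℝ) * Real.pi * ((1 / 2 : ℝ≥0) : ℝ) = Real.pi := by push_cast; ring
    have h3 : (2 : ℝ) * ((1 / 2 : ℝ≥0) : ℝ) = 1 := by push_cast; ring
    rw [h2, h3, mul_mul_mul_comm, ← Real.exp_add, ← mul_inv, Real.mul_self_sqrt Real.pi_pos.le]
    congr 2
    ring
  have hmp := Complex.volume_preserving_equiv_real_prod.symm
  ext s hs
  rw [complexGaussian, gaussianReal_of_var_ne_zero 0 hv,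
    prod_withDensity (measurable_gaussianPDF _ _) (measurable_gaussianPDF _ _)]
  have hmeas : Measurable fun q : ℝ × ℝ => (⟨q.1, q.2⟩ : ℂ) := hmp.measurable
  rw [Measure.map_apply hmeas hs, withDensity_apply _ (hmeas hs), withDensity_apply _ hs,
    ← hmp.setLIntegral_comp_preimage hs (by fun_prop)]
  simp_rw [hdens]
  rfl

instance : IsProbabilityMeasure complexGaussian :=
  Measure.isProbabilityMeasure_map
    (Complex.volume_preserving_equiv_real_prod.symm.measurable.aemeasurable)

theorem lintegral_gaussDensity : ∫⁻ u, ENNReal.ofReal (gaussDensity u) = 1 := by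
  have h : complexGaussian Set.univ = 1 := measure_univ
  rwa [complexGaussian_eq_withDensity, withDensity_apply _ MeasurableSet.univ,
    Measure.restrict_univ] at h

theorem lintegral_sq_gaussianReal_half :
    ∫⁻ x, ENNReal.ofReal (x ^ 2) ∂(gaussianReal 0 (1 / 2)) = ENNReal.ofReal (1 / 2) := by
  have h : Var[fun x => x; gaussianReal 0 (1 / 2)] = ((1 / 2 : ℝ≥0) : ℝ) :=
    variance_fun_id_gaussianReal
  rw [variance_eq_integral (by fun_prop)] at h
  simp only [integral_id_gaussianReal, sub_zero] at h
  rw [← ofReal_integral_eq_lintegral_ofReal, h]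
  · norm_num
  · exact (memLp_id_gaussianReal (μ := 0) (v := 1 / 2) 2).integrable_sq
  · exact Filter.Eventually.of_forall fun x => sq_nonneg x

theorem lintegral_norm_sq_complexGaussian :
    ∫⁻ z, ENNReal.ofReal (‖z‖ ^ 2) ∂complexGaussian = 1 := by
  have hmeas : Measurable fun q : ℝ × ℝ => (⟨q.1, q.2⟩ : ℂ) :=
    Complex.volume_preserving_equiv_real_prod.symm.measurable
  rw [complexGaussian, lintegral_map (by fun_prop) hmeas]
  have : ∀ q : ℝ × ℝ, ENNReal.ofReal (‖(⟨q.1, q.2⟩ : ℂ)‖ ^ 2) =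
      ENNReal.ofReal (q.1 ^ 2) + ENNReal.ofReal (q.2 ^ 2) := by
    intro q
    rw [← ENNReal.ofReal_add (sq_nonneg _) (sq_nonneg _), Complex.sq_norm, Complex.normSq_mk]
    congr 1; ring
  simp_rw [this]
  rw [lintegral_add_left (by fun_prop), lintegral_prod _ (by fun_prop),
    lintegral_prod _ (by fun_prop)]
  simp only [lintegral_const, measure_univ, mul_one, lintegral_sq_gaussianReal_half]
  rw [← ENNReal.ofReal_add (by norm_num) (by norm_num)]
  norm_num

/-! The heavy-tailed comparison kernel. -/

/-- In polar coordinates the integrand becomes `x * (1 + x ^ 2) ^ (-1 - δ)`, which has an elementary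
antiderivative. The growth `1 / δ` of the mass becomes the double logarithm in the final error. -/
theorem lintegral_one_add_sq_rpow {δ : ℝ} (hδ : 0 < δ) :
    ∫⁻ u : ℂ, ENNReal.ofReal ((1 + ‖u‖ ^ 2) ^ (-1 - δ)) = ENNReal.ofReal (Real.pi / δ) := by
  have hder : ∀ x ∈ Set.Ici (0 : ℝ), HasDerivAt
      (fun x : ℝ => -(1 / (2 * δ)) * (1 + x ^ 2) ^ (-δ)) (x * (1 + x ^ 2) ^ (-1 - δ)) x := by
    intro x _
    have h0 : (0 : ℝ) < 1 + x ^ 2 := by positivity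
    have h1 : HasDerivAt (fun x : ℝ => 1 + x ^ 2) (2 * x) x := by
      simpa using ((hasDerivAt_pow 2 x).const_add 1)
    have h2 := (h1.rpow_const (p := -δ) (Or.inl h0.ne')).const_mul (-(1 / (2 * δ)))
    convert! h2 using 1
    rw [show -δ - 1 = -1 - δ by ring]
    field_simp
  have hpos : ∀ x ∈ Set.Ioi (0 : ℝ), 0 ≤ x * (1 + x ^ 2) ^ (-1 - δ) := by
    intro x hx
    have : (0 : ℝ) < x := hx
    positivity
  have hlim : Filter.Tendsto (fun x : ℝ => -(1 / (2 * δ)) * (1 + x ^ 2) ^ (-δ))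
      Filter.atTop (nhds (-(1 / (2 * δ)) * 0)) := by
    refine Filter.Tendsto.const_mul _ ((tendsto_rpow_neg_atTop hδ).comp ?_)
    exact Filter.tendsto_atTop_add_const_left _ _ (Filter.tendsto_pow_atTop two_ne_zero)
  have hint := integrableOn_Ioi_deriv_of_nonneg' hder hpos hlim
  have hval := integral_Ioi_of_hasDerivAt_of_nonneg' hder hpos hlim
  have hrad : ∫⁻ x in Set.Ioi (0 : ℝ), ENNReal.ofReal (x * (1 + x ^ 2) ^ (-1 - δ)) =
      ENNReal.ofReal (1 / (2 * δ)) := by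
    rw [← ofReal_integral_eq_lintegral_ofReal hint
      ((ae_restrict_iff' measurableSet_Ioi).2 (Filter.Eventually.of_forall hpos)), hval]
    simp
  rw [← Complex.lintegral_comp_polarCoord_symm, polarCoord_target,
    Measure.volume_eq_prod, ← Measure.prod_restrict]
  simp only [Complex.norm_polarCoord_symm, sq_abs, smul_eq_mul]
  rw [lintegral_prod _ (by fun_prop)]
  simp only [lintegral_const, Measure.restrict_apply MeasurableSet.univ, Set.univ_inter, Real.volume_Ioo]
  have hcongr : ∀ x ∈ Set.Ioi (0 : ℝ), ENNReal.ofReal x * ENNReal.ofReal ((1 + x ^ 2) ^ (-1 - δ)) *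
      ENNReal.ofReal (Real.pi - -Real.pi) =
      ENNReal.ofReal (x * (1 + x ^ 2) ^ (-1 - δ)) * ENNReal.ofReal (2 * Real.pi) := by
    intro x hx
    rw [ENNReal.ofReal_mul (le_of_lt hx)]
    congr 2; ring
  rw [setLIntegral_congr_fun measurableSet_Ioi hcongr, lintegral_mul_const _ (by fun_prop), hrad,
    ← ENNReal.ofReal_mul (by positivity)]
  congr 1
  field_simp

/-- Whichever of `s` and `t` is smaller, both factors can be evaluated there at the cost of an
increase. The two variables are thereby separated, which makes the next integral bound uniform in
the shift `a`. -/
theorem kernel_mul_weight_le {δ : ℝ} (hδ : 0 < δ) {s t : ℝ} (hs : 0 ≤ s) (ht : 0 ≤ t) :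
    (1 + s)⁻¹ * (1 + t) ^ (-δ) ≤ (1 + s) ^ (-1 - δ) + (1 + t) ^ (-1 - δ) := by
  have hs' : (0 : ℝ) < 1 + s := by linarith
  have ht' : (0 : ℝ) < 1 + t := by linarith
  have key : ∀ r : ℝ, 0 < 1 + r → (1 + r) ^ (-1 - δ) = (1 + r)⁻¹ * (1 + r) ^ (-δ) := by
    intro r hr
    rw [sub_eq_add_neg, Real.rpow_add hr, Real.rpow_neg_one]
  rcases le_total s t with h | h
  · have : (1 + t) ^ (-δ) ≤ (1 + s) ^ (-δ) :=
      Real.rpow_le_rpow_of_nonpos hs' (by linarith) (by linarith)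
    have h3 := mul_le_mul_of_nonneg_left this (inv_nonneg.2 hs'.le)
    rw [← key s hs'] at h3
    have : 0 ≤ (1 + t) ^ (-1 - δ) := Real.rpow_nonneg ht'.le _
    linarith
  · have : (1 + s)⁻¹ ≤ (1 + t)⁻¹ := inv_anti₀ ht' (by linarith)
    have h3 := mul_le_mul_of_nonneg_right this (Real.rpow_nonneg ht'.le (-δ))
    rw [← key t ht'] at h3
    have : 0 ≤ (1 + s) ^ (-1 - δ) := Real.rpow_nonneg hs'.le _
    linarith

theorem lintegral_kernel_mul_weight_le {δ : ℝ} (hδ : 0 < δ) (a : ℂ) :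
    ∫⁻ y : ℂ, ENNReal.ofReal ((1 + ‖y - a‖ ^ 2)⁻¹ * (1 + ‖y‖ ^ 2) ^ (-δ)) ≤
      ENNReal.ofReal (2 * Real.pi / δ) := by
  calc ∫⁻ y : ℂ, ENNReal.ofReal ((1 + ‖y - a‖ ^ 2)⁻¹ * (1 + ‖y‖ ^ 2) ^ (-δ))
      ≤ ∫⁻ y : ℂ, (ENNReal.ofReal ((1 + ‖y - a‖ ^ 2) ^ (-1 - δ)) +
          ENNReal.ofReal ((1 + ‖y‖ ^ 2) ^ (-1 - δ))) := by
        refine lintegral_mono fun y => ?_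
        rw [← ENNReal.ofReal_add (by positivity) (by positivity)]
        exact ENNReal.ofReal_le_ofReal
          (kernel_mul_weight_le hδ (sq_nonneg _) (sq_nonneg _))
    _ = ENNReal.ofReal (2 * Real.pi / δ) := by
        rw [lintegral_add_left (by fun_prop),
          lintegral_sub_right_eq_self (fun u : ℂ => ENNReal.ofReal ((1 + ‖u‖ ^ 2) ^ (-1 - δ))) a,
          lintegral_one_add_sq_rpow hδ, ← ENNReal.ofReal_add (by positivity) (by positivity)]
        congr 1; ring

/-! A random row with bounded density is unlikely to be almost orthogonal to a given vector. -/

/-- The law is dominated by `F` times Lebesgue measure, and `u ↦ u * b + w` multiplies planar area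
by `‖b‖ ^ 2`, while the Gaussian density has mass `1`. -/
theorem lintegral_gaussDensity_affine_le {dmax F : ℝ} {law : Measure ℂ}
    (h : IsChannelLaw dmax F law) {b : ℂ} (hb : b ≠ 0) (w : ℂ) :
    ∫⁻ u, ENNReal.ofReal (gaussDensity (u * b + w)) ∂law ≤ ENNReal.ofReal (F / ‖b‖ ^ 2) := by
  obtain ⟨f, hf, hlaw, hle⟩ := h.density
  have hmeas : Measurable fun u : ℂ => ENNReal.ofReal (gaussDensity (u * b + w)) := by fun_prop
  have hr : ‖b‖ ≠ 0 := norm_ne_zero_iff.2 hb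
  have hscale : ∫⁻ u : ℂ, ENNReal.ofReal (gaussDensity (u * b + w)) =
      ENNReal.ofReal (1 / ‖b‖ ^ 2) := by
    -- Multiplication by the unit `‖b‖ / b` does not change the density and turns the complex factor
    -- `b` into the real factor `‖b‖`, so the real scaling rule for Haar measure applies, in
    -- dimension two.
    have h1 : ∀ u : ℂ, gaussDensity (u * b + w) = gaussDensity (‖b‖ • u + ‖b‖ / b * w) := by
      intro u
      have hb' : (‖b‖ : ℂ) ≠ 0 := by exact_mod_cast hr
      have h2 : ‖b‖ • u + ‖b‖ / b * w = ‖b‖ / b * (u * b + w) := by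
        rw [Complex.real_smul]; field_simp
      rw [h2, gaussDensity, gaussDensity, norm_mul, norm_div, Complex.norm_real, norm_norm,
        div_self hr, one_mul]
    simp_rw [h1]
    have h3 := lintegral_map (μ := (volume : Measure ℂ)) (g := fun u : ℂ => ‖b‖ • u)
      (f := fun u => ENNReal.ofReal (gaussDensity (u + ‖b‖ / b * w))) (by fun_prop) (by fun_prop)
    rw [← h3, Measure.map_addHaar_smul _ hr, lintegral_smul_measure,
      lintegral_add_right_eq_self (fun u => ENNReal.ofReal (gaussDensity u)),
      lintegral_gaussDensity, Complex.finrank_real_complex, smul_eq_mul, mul_one,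
      abs_of_nonneg (by positivity), one_div]
  calc ∫⁻ u, ENNReal.ofReal (gaussDensity (u * b + w)) ∂law
      = ∫⁻ u, f u * ENNReal.ofReal (gaussDensity (u * b + w)) := by
        rw [hlaw, lintegral_withDensity_eq_lintegral_mul _ hf hmeas]; rfl
    _ ≤ ∫⁻ u, ENNReal.ofReal F * ENNReal.ofReal (gaussDensity (u * b + w)) :=
        lintegral_mono fun u => mul_le_mul_left (hle u) _
    _ = ENNReal.ofReal (F / ‖b‖ ^ 2) := by
        rw [lintegral_const_mul _ hmeas, hscale, ← ENNReal.ofReal_mul' (by positivity)]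
        congr 1; ring

theorem IsChannelLaw.pos {dmax F : ℝ} {law : Measure ℂ} (h : IsChannelLaw dmax F law) : 0 < F := by
  by_contra hF
  obtain ⟨f, -, hlaw, hle⟩ := h.density
  have hf0 : f = 0 := by
    ext z
    simpa [ENNReal.ofReal_of_nonpos (not_lt.1 hF)] using hle z
  have h1 := h.isProbabilityMeasure.measure_univ
  simp [hlaw, hf0] at h1

/-- The norm on `Fin m → ℂ` is the maximum norm, so some coordinate satisfies `‖d i‖ = ‖d‖`.
Integrating over `g i` alone, with the other coefficients frozen into the shift, gives `F / ‖d‖ ^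
2`; the trivial bound `1` covers small `d`. -/
theorem lintegral_gaussDensity_row_le {dmax F : ℝ} {law : Measure ℂ} (h : IsChannelLaw dmax F law)
    {m : ℕ} (d : Fin m → ℂ) (w : ℂ) :
    ∫⁻ g, ENNReal.ofReal (gaussDensity ((∑ i, g i * d i) + w)) ∂(Measure.pi fun _ : Fin m => law) ≤
      ENNReal.ofReal ((1 + F) / (1 + ‖d‖ ^ 2)) := by
  have := h.isProbabilityMeasure
  have hF := h.pos
  have hle1 : ∫⁻ g, ENNReal.ofReal (gaussDensity ((∑ i, g i * d i) + w))
      ∂(Measure.pi fun _ : Fin m => law) ≤ 1 := by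
    calc _ ≤ ∫⁻ _, 1 ∂(Measure.pi fun _ : Fin m => law) :=
          lintegral_mono fun g => by
            rw [← ENNReal.ofReal_one]
            exact ENNReal.ofReal_le_ofReal (gaussDensity_le_one _)
      _ = 1 := by simp
  rcases eq_or_ne d 0 with rfl | hd
  · refine hle1.trans ?_
    rw [← ENNReal.ofReal_one]
    exact ENNReal.ofReal_le_ofReal (by simp [hF.le])
  obtain ⟨i, hi⟩ : ∃ i, ‖d i‖ = ‖d‖ := by
    by_contra! hne
    have hlt : ‖d‖ < ‖d‖ := (pi_norm_lt_iff (norm_pos_iff.2 hd)).2 fun i =>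
      lt_of_le_of_ne (norm_le_pi_norm d i) (hne i)
    exact lt_irrefl _ hlt
  have hdpos : 0 < ‖d‖ := norm_pos_iff.2 hd
  have hdi : d i ≠ 0 := norm_pos_iff.1 (hi ▸ hdpos)
  have hle2 : ∫⁻ g, ENNReal.ofReal (gaussDensity ((∑ i, g i * d i) + w))
      ∂(Measure.pi fun _ : Fin m => law) ≤ ENNReal.ofReal (F / ‖d‖ ^ 2) := by
    obtain ⟨m, rfl⟩ : ∃ m', m = m' + 1 := ⟨m - 1, by have := i.pos; omega⟩
    have hp := (measurePreserving_piFinSuccAbove (fun _ : Fin (m + 1) => law) i).symm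
    have hm : Measurable fun g : Fin (m + 1) → ℂ =>
        ENNReal.ofReal (gaussDensity ((∑ i, g i * d i) + w)) := by fun_prop
    rw [← hp.lintegral_comp hm]
    simp only [Fin.sum_univ_succAbove _ i, MeasurableEquiv.piFinSuccAbove_symm_apply,
      Fin.insertNthEquiv_apply, Fin.insertNth_apply_same, Fin.insertNth_apply_succAbove]
    rw [lintegral_prod_symm _ (by fun_prop)]
    calc _ ≤ ∫⁻ _, ENNReal.ofReal (F / ‖d‖ ^ 2) ∂(Measure.pi fun _ : Fin m => law) := by
          refine lintegral_mono fun x => ?_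
          simp_rw [add_assoc]
          rw [← hi]
          exact lintegral_gaussDensity_affine_le h hdi _
      _ = _ := by simp
  -- If `x = min 1 (F / ‖d‖ ^ 2)`, then `x ≤ 1` and `x * ‖d‖ ^ 2 ≤ F`; the sum of the two is the
  -- bound wanted.
  have hmin := le_min hle1 hle2
  refine hmin.trans ?_
  rw [← ENNReal.ofReal_one, ← ENNReal.ofReal_min]
  refine ENNReal.ofReal_le_ofReal ?_
  rw [le_div_iff₀ (by positivity), mul_add, mul_one]
  refine add_le_add (min_le_left _ _) ?_
  calc min 1 (F / ‖d‖ ^ 2) * ‖d‖ ^ 2 ≤ F / ‖d‖ ^ 2 * ‖d‖ ^ 2 := by gcongr; exact min_le_right _ _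
    _ = F := by field_simp

/-! ### Blocks of noise and of channel matrices -/

/-- The joint density of a block of i.i.d. `CN(0, 1)` samples. -/
noncomputable def blockDensity {n a : ℕ} (z : Fin n → Fin a → ℂ) : ℝ≥0∞ :=
  ∏ t, ∏ r, ENNReal.ofReal (gaussDensity (z t r))

@[fun_prop]
theorem measurable_blockDensity {n a : ℕ} :
    Measurable (blockDensity : (Fin n → Fin a → ℂ) → ℝ≥0∞) := by
  unfold blockDensity
  fun_prop

/-- The law of a block of i.i.d. `CN(0, 1)` samples. -/
noncomputable def blockNoise (n a : ℕ) : Measure (Fin n → Fin a → ℂ) :=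
  Measure.pi fun _ => Measure.pi fun _ => complexGaussian

instance (n a : ℕ) : IsProbabilityMeasure (blockNoise n a) := by
  unfold blockNoise; infer_instance

theorem blockNoise_eq_withDensity (n a : ℕ) :
    blockNoise n a = volume.withDensity blockDensity := by
  have : IsProbabilityMeasure (volume.withDensity fun u => ENNReal.ofReal (gaussDensity u)) := by
    rw [← complexGaussian_eq_withDensity]; infer_instance
  have h1 : (Measure.pi fun _ : Fin a => complexGaussian) =
      volume.withDensity fun x : Fin a → ℂ => ∏ r, ENNReal.ofReal (gaussDensity (x r)) := by
    rw [complexGaussian_eq_withDensity, pi_withDensity _ _ (by fun_prop)]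
    rfl
  have : IsProbabilityMeasure (volume.withDensity
      fun x : Fin a → ℂ => ∏ r, ENNReal.ofReal (gaussDensity (x r))) := by
    rw [← h1]; infer_instance
  rw [blockNoise, h1, pi_withDensity _ _ (by fun_prop)]
  rfl

/-- `n` channel matrices with `a` rows and i.i.d. entries. -/
noncomputable def blockChannel (m n a : ℕ) (law : Measure ℂ) :
    Measure (Fin n → Fin a → Fin m → ℂ) :=
  Measure.pi fun _ => Measure.pi fun _ => Measure.pi fun _ => law

/-- For a fixed difference `d` the pairs of row and noise sample are independent over slots and
antennas, so the integral factors into the single-row bounds; these do not depend on the shift by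
the noise. -/
theorem lintegral_blockDensity_le {dmax F : ℝ} {law : Measure ℂ} (h : IsChannelLaw dmax F law)
    {m n : ℕ} (a : ℕ) (d : Fin n → Fin m → ℂ) :
    ∫⁻ g, ∫⁻ z, blockDensity (fun t r => (∑ i, g t r i * d t i) + z t r) ∂(blockNoise n a)
        ∂(blockChannel m n a law) ≤
      ∏ t, ENNReal.ofReal ((1 + F) / (1 + ‖d t‖ ^ 2)) ^ a := by
  have := h.isProbabilityMeasure
  have h1 : ∀ g : Fin n → Fin a → Fin m → ℂ,
      ∫⁻ z, blockDensity (fun t r => (∑ i, g t r i * d t i) + z t r) ∂(blockNoise n a) =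
      ∏ t, ∏ r, ∫⁻ w, ENNReal.ofReal (gaussDensity ((∑ i, g t r i * d t i) + w))
        ∂complexGaussian := by
    intro g
    unfold blockDensity blockNoise
    rw [lintegral_pi_prod _ (fun t (x : Fin a → ℂ) =>
      ∏ r, ENNReal.ofReal (gaussDensity ((∑ i, g t r i * d t i) + x r))) fun t => by fun_prop]
    refine Finset.prod_congr rfl fun t _ => ?_
    exact lintegral_pi_prod _ (fun r (x : ℂ) =>
      ENNReal.ofReal (gaussDensity ((∑ i, g t r i * d t i) + x))) fun r => by fun_prop
  have hm : ∀ t, Measurable fun x : Fin m → ℂ =>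
      ∫⁻ w, ENNReal.ofReal (gaussDensity ((∑ i, x i * d t i) + w)) ∂complexGaussian := fun t =>
    Measurable.lintegral_prod_right' (f := fun q : (Fin m → ℂ) × ℂ =>
      ENNReal.ofReal (gaussDensity ((∑ i, q.1 i * d t i) + q.2))) (by fun_prop)
  simp_rw [h1]
  unfold blockChannel
  rw [lintegral_pi_prod _ (fun t (x : Fin a → Fin m → ℂ) => ∏ r, ∫⁻ w, ENNReal.ofReal
    (gaussDensity ((∑ i, x r i * d t i) + w)) ∂complexGaussian) fun t =>
      Finset.measurable_prod _ fun r _ => (hm t).comp (measurable_pi_apply r)]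
  refine Finset.prod_le_prod' fun t _ => ?_
  rw [lintegral_pi_prod _ (fun r (x : Fin m → ℂ) => ∫⁻ w, ENNReal.ofReal
    (gaussDensity ((∑ i, x i * d t i) + w)) ∂complexGaussian) fun r => hm t]
  rw [Finset.prod_const, Finset.card_univ, Fintype.card_fin]
  gcongr
  rw [lintegral_lintegral_swap (by fun_prop)]
  calc _ ≤ ∫⁻ _, ENNReal.ofReal ((1 + F) / (1 + ‖d t‖ ^ 2)) ∂complexGaussian :=
        lintegral_mono fun w => lintegral_gaussDensity_row_le h _ _
    _ = _ := by simp

/-! Marginals of the channel and the noise. -/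

theorem pi_map_castLE {α : Type*} [MeasurableSpace α] (μ : Measure α) [IsProbabilityMeasure μ]
    {a b : ℕ} (h : a ≤ b) :
    (Measure.pi fun _ : Fin b => μ).map (fun x (r : Fin a) => x (Fin.castLE h r)) =
      Measure.pi fun _ : Fin a => μ := by
  have h1 : iIndepFun (fun (i : Fin b) (x : Fin b → α) => x i) (Measure.pi fun _ => μ) :=
    iIndepFun_pi (X := fun _ x => x) fun _ => aemeasurable_id
  have h2 := h1.precomp (Fin.castLE_injective h)
  rw [iIndepFun_iff_map_fun_eq_pi_map fun i => (measurable_pi_apply _).aemeasurable] at h2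
  refine h2.trans ?_
  congr 1
  ext1 i
  exact (measurePreserving_eval (fun _ : Fin b => μ) (Fin.castLE h i)).map_eq

section Marginals

variable {k m : ℕ} {N : Fin (k + 1) → ℕ} {n : ℕ}

theorem noiseMeasure_map (j : Fin (k + 1)) {a : ℕ} (ha : a ≤ N j) :
    (noiseMeasure N n).map (fun z t (r : Fin a) => z t j (Fin.castLE ha r)) = blockNoise n a := by
  have hslot : (Measure.pi fun j : Fin (k + 1) => Measure.pi fun _ : Fin (N j) =>
      complexGaussian).map (fun x (r : Fin a) => x j (Fin.castLE ha r)) =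
      Measure.pi fun _ => complexGaussian := by
    rw [← pi_map_castLE complexGaussian ha, ← (measurePreserving_eval (fun j : Fin (k + 1) =>
      Measure.pi fun _ : Fin (N j) => complexGaussian) j).map_eq,
      Measure.map_map (by fun_prop) (by fun_prop)]
    rfl
  have : IsProbabilityMeasure ((Measure.pi fun j : Fin (k + 1) => Measure.pi fun _ : Fin (N j) =>
      complexGaussian).map (fun x (r : Fin a) => x j (Fin.castLE ha r))) := by
    rw [hslot]; infer_instance
  refine (Measure.pi_map_pi (μ := fun _ : Fin n => Measure.pi fun j : Fin (k + 1) =>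
    Measure.pi fun _ : Fin (N j) => complexGaussian)
    (f := fun _ x (r : Fin a) => x j (Fin.castLE ha r)) fun _ => ?_).trans ?_
  · exact Measurable.aemeasurable (by fun_prop)
  · simp_rw [hslot]
    rfl

/-- This is where the transmitter's ignorance of the eavesdropper enters: with `j = 0` the inputs
are functions of the first component, and the rows at receiver `j'` are independent of it. -/
theorem channelMeasure_map_pair {law : Measure ℂ} [IsProbabilityMeasure law] {j j' : Fin (k + 1)}
    (hj : j ≠ j') {a : ℕ} (ha : a ≤ N j') :
    (channelMeasure m N n law).map
        (fun g => (fun t => g t j, fun t (r : Fin a) => g t j' (Fin.castLE ha r))) =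
      (blockChannel m n (N j) law).prod (blockChannel m n a law) := by
  set ν : (i : Fin (k + 1)) → Measure (Fin (N i) → Fin m → ℂ) :=
    fun i => Measure.pi fun _ => Measure.pi fun _ => law with hν
  have h1 : IndepFun (fun x : (i : Fin (k + 1)) → Fin (N i) → Fin m → ℂ => x j)
      (fun x => fun r : Fin a => x j' (Fin.castLE ha r)) (Measure.pi ν) := by
    have h2 : iIndepFun (fun i (x : (i : Fin (k + 1)) → Fin (N i) → Fin m → ℂ) => x i)
        (Measure.pi ν) := iIndepFun_pi (X := fun _ x => x) fun _ => aemeasurable_id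
    exact (h2.indepFun hj).comp (φ := id) (ψ := fun x (r : Fin a) => x (Fin.castLE ha r))
      measurable_id (by fun_prop)
  have hmap : (Measure.pi ν).map (fun x => fun r : Fin a => x j' (Fin.castLE ha r)) =
      Measure.pi fun _ => Measure.pi fun _ => law := by
    rw [← pi_map_castLE (Measure.pi fun _ : Fin m => law) ha,
      show (Measure.pi fun _ : Fin (N j') => Measure.pi fun _ : Fin m => law) = ν j' from rfl,
      ← (measurePreserving_eval ν j').map_eq, Measure.map_map (by fun_prop) (by fun_prop)]
    rfl
  have hslot : (Measure.pi ν).map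
      (fun x => (x j, fun r : Fin a => x j' (Fin.castLE ha r))) =
      (ν j).prod (Measure.pi fun _ => Measure.pi fun _ => law) := by
    rw [(indepFun_iff_map_prod_eq_prod_map_map (measurable_pi_apply j).aemeasurable
      (Measurable.aemeasurable (by fun_prop))).1 h1, hmap]
    congr 1
    exact (measurePreserving_eval ν j).map_eq
  have : IsProbabilityMeasure ((Measure.pi ν).map
      (fun x => (x j, fun r : Fin a => x j' (Fin.castLE ha r)))) := by
    rw [hslot]; infer_instance
  have h3 : (channelMeasure m N n law).map
      (fun g t => (g t j, fun r : Fin a => g t j' (Fin.castLE ha r))) =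
      Measure.pi fun _ => (ν j).prod (Measure.pi fun _ => Measure.pi fun _ => law) := by
    refine (Measure.pi_map_pi (μ := fun _ : Fin n => Measure.pi ν)
      (f := fun _ x => (x j, fun r : Fin a => x j' (Fin.castLE ha r))) fun _ => ?_).trans ?_
    · exact Measurable.aemeasurable (by fun_prop)
    · simp_rw [hslot]
  have h4 := measurePreserving_arrowProdEquivProdArrow (Fin (N j) → Fin m → ℂ)
    (Fin a → Fin m → ℂ) (Fin n) (fun _ => ν j)
    (fun _ => Measure.pi fun _ => Measure.pi fun _ => law)
  refine Eq.trans ?_ h4.map_eq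
  rw [← h3, Measure.map_map h4.measurable (by fun_prop)]
  rfl

theorem ae_norm_channel_le {dmax F : ℝ} {law : Measure ℂ} (h : IsChannelLaw dmax F law) :
    ∀ᵐ g ∂(channelMeasure m N n law), ∀ t j r i, ‖g t j r i‖ ≤ dmax := by
  have := h.isProbabilityMeasure
  simp_rw [ae_all_iff]
  intro t j r i
  have h1 := measurePreserving_eval (fun _ : Fin m => law) i
  have h2 := measurePreserving_eval (fun _ : Fin (N j) => Measure.pi fun _ : Fin m => law) r
  have h3 := measurePreserving_eval (fun j : Fin (k + 1) =>
    Measure.pi fun _ : Fin (N j) => Measure.pi fun _ : Fin m => law) j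
  have h4 := measurePreserving_eval (fun _ : Fin n => Measure.pi fun j : Fin (k + 1) =>
    Measure.pi fun _ : Fin (N j) => Measure.pi fun _ : Fin m => law) t
  exact (h1.comp (h2.comp (h3.comp h4))).quasiMeasurePreserving.ae h.bounded

instance {law : Measure ℂ} [IsProbabilityMeasure law] :
    IsProbabilityMeasure (channelMeasure m N n law) := by
  unfold channelMeasure; infer_instance

instance {law : Measure ℂ} [IsProbabilityMeasure law] {a : ℕ} :
    IsProbabilityMeasure (blockChannel m n a law) := by
  unfold blockChannel; infer_instance

instance : IsProbabilityMeasure (noiseMeasure N n) := by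
  unfold noiseMeasure; infer_instance

end Marginals

/-! ### Bounds and energy of blocks -/

theorem blockDensity_pos {n a : ℕ} (z : Fin n → Fin a → ℂ) : 0 < blockDensity z :=
  pos_iff_ne_zero.2 <| Finset.prod_ne_zero_iff.2 fun _ _ => Finset.prod_ne_zero_iff.2 fun _ _ =>
    (ENNReal.ofReal_pos.2 (gaussDensity_pos _)).ne'

theorem blockDensity_le_one {n a : ℕ} (z : Fin n → Fin a → ℂ) : blockDensity z ≤ 1 :=
  Finset.prod_le_one' fun _ _ => Finset.prod_le_one' fun _ _ => by
    rw [← ENNReal.ofReal_one]; exact ENNReal.ofReal_le_ofReal (gaussDensity_le_one _)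

/-- The energy of a block. -/
noncomputable def energy {n a : ℕ} (z : Fin n → Fin a → ℂ) : ℝ :=
  ∑ t, ∑ r, ‖z t r‖ ^ 2

theorem energy_nonneg {n a : ℕ} (z : Fin n → Fin a → ℂ) : 0 ≤ energy z :=
  Finset.sum_nonneg fun _ _ => Finset.sum_nonneg fun _ _ => sq_nonneg _

@[fun_prop]
theorem measurable_energy {n a : ℕ} : Measurable (energy : (Fin n → Fin a → ℂ) → ℝ) := by
  unfold energy; fun_prop

theorem energy_add_le {n a : ℕ} (x y : Fin n → Fin a → ℂ) :
    energy (x + y) ≤ 2 * energy x + 2 * energy y := by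
  simp only [energy, Finset.mul_sum, ← Finset.sum_add_distrib]
  refine Finset.sum_le_sum fun t _ => Finset.sum_le_sum fun r _ => ?_
  have h : ‖(x + y) t r‖ ≤ ‖x t r‖ + ‖y t r‖ := norm_add_le _ _
  nlinarith [sq_nonneg (‖x t r‖ - ‖y t r‖), norm_nonneg ((x + y) t r)]

theorem energy_neg {n a : ℕ} (x : Fin n → Fin a → ℂ) : energy (-x) = energy x := by
  simp [energy]

theorem blockDensity_eq {n a : ℕ} (z : Fin n → Fin a → ℂ) :
    blockDensity z = ENNReal.ofReal (Real.exp (-(n * a * Real.log Real.pi + energy z))) := by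
  unfold blockDensity
  simp_rw [← ENNReal.ofReal_prod_of_nonneg fun i (_ : i ∈ Finset.univ) => (gaussDensity_pos _).le]
  rw [← ENNReal.ofReal_prod_of_nonneg
    fun i _ => Finset.prod_nonneg fun j _ => (gaussDensity_pos _).le]
  have h : ∀ u, gaussDensity u = Real.exp (-(Real.log Real.pi + ‖u‖ ^ 2)) := by
    intro u
    rw [gaussDensity, neg_add, Real.exp_add, Real.exp_neg (Real.log Real.pi),
      Real.exp_log Real.pi_pos]
  simp_rw [h, ← Real.exp_sum]
  congr 2
  simp [energy, Finset.sum_add_distrib, mul_assoc]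

theorem lintegral_noise_coord {n a : ℕ} (t : Fin n) (r : Fin a) :
    ∫⁻ z, ENNReal.ofReal (‖z t r‖ ^ 2) ∂(blockNoise n a) = 1 := by
  have h1 := measurePreserving_eval (fun _ : Fin a => complexGaussian) r
  have h2 := measurePreserving_eval
    (fun _ : Fin n => Measure.pi fun _ : Fin a => complexGaussian) t
  rw [← lintegral_norm_sq_complexGaussian]
  exact (h1.comp h2).lintegral_comp (f := fun z => ENNReal.ofReal (‖z‖ ^ 2)) (by fun_prop)

theorem lintegral_energy_noise (n a : ℕ) :
    ∫⁻ z, ENNReal.ofReal (energy z) ∂(blockNoise n a) = n * a := by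
  unfold energy
  simp_rw [ENNReal.ofReal_sum_of_nonneg fun (i : Fin n) (_ : i ∈ Finset.univ) =>
    Finset.sum_nonneg fun (r : Fin a) _ => sq_nonneg _,
    ENNReal.ofReal_sum_of_nonneg fun (i : Fin a) (_ : i ∈ Finset.univ) => sq_nonneg _]
  rw [lintegral_finsetSum _ fun _ _ => by fun_prop]
  have h : ∀ t, ∫⁻ z, ∑ r, ENNReal.ofReal (‖z t r‖ ^ 2) ∂(blockNoise n a) = a := fun t => by
    rw [lintegral_finsetSum _ fun _ _ => by fun_prop]
    simp only [lintegral_noise_coord]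
    simp
  simp only [h]
  simp

/-! The density of a signal observed in Gaussian noise. -/

section Additive

variable {Ω T S : Type*} [MeasurableSpace Ω] [MeasurableSpace T] {n a : ℕ}

/-- The conditional density of `A s g + z` given `g`, where `s` has the law `ρ` and `z` is a block
of noise. -/
noncomputable def outDensity (ρ : Measure T) (A : T → S → Fin n → Fin a → ℂ)
    (q : S × (Fin n → Fin a → ℂ)) : ℝ≥0∞ :=
  ∫⁻ s, blockDensity (q.2 - A s q.1) ∂ρ

variable {ρ : Measure T} [IsProbabilityMeasure ρ] {A : T → S → Fin n → Fin a → ℂ}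

theorem outDensity_le_one (q : S × (Fin n → Fin a → ℂ)) : outDensity ρ A q ≤ 1 := by
  calc outDensity ρ A q ≤ ∫⁻ _, 1 ∂ρ := lintegral_mono fun s => blockDensity_le_one _
    _ = 1 := by simp

variable [MeasurableSpace S] {γ : Measure S} [IsProbabilityMeasure γ]

theorem measurable_outDensity (hA : Measurable fun q : T × S => A q.1 q.2) :
    Measurable (outDensity ρ A) := by
  refine Measurable.lintegral_prod_right'
    (f := fun q : (S × (Fin n → Fin a → ℂ)) × T => blockDensity (q.1.2 - A q.2 q.1.1)) ?_
  have h1 : Measurable fun q : (S × (Fin n → Fin a → ℂ)) × T => A q.2 q.1.1 :=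
    hA.comp (by fun_prop : Measurable fun q : (S × (Fin n → Fin a → ℂ)) × T => (q.2, q.1.1))
  fun_prop

theorem measurable_shift (hA : Measurable fun q : T × S => A q.1 q.2) (g : S)
    (y : Fin n → Fin a → ℂ) : Measurable fun s => y - A s g := by
  have : Measurable fun s => A s g := hA.comp (by fun_prop : Measurable fun s : T => (s, g))
  fun_prop

theorem outDensity_pos (hA : Measurable fun q : T × S => A q.1 q.2)
    (q : S × (Fin n → Fin a → ℂ)) : 0 < outDensity ρ A q := by
  have := measurable_shift hA q.1 q.2
  rw [outDensity, lintegral_pos_iff_support (by fun_prop)]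
  rw [Function.support_eq_univ fun s => (blockDensity_pos _).ne']
  simp

theorem outDensity_toReal_pos (hA : Measurable fun q : T × S => A q.1 q.2)
    (q : S × (Fin n → Fin a → ℂ)) : 0 < (outDensity ρ A q).toReal :=
  ENNReal.toReal_pos (outDensity_pos hA q).ne'
    ((outDensity_le_one q).trans_lt ENNReal.one_lt_top).ne

/-- For fixed `s` and `g` the output is a translate of the noise, so its density is a translate of
`blockDensity`; Tonelli's theorem then averages over `s`. -/
theorem map_additive_eq_withDensity (hA : Measurable fun q : T × S => A q.1 q.2) :
    (ρ.prod (γ.prod (blockNoise n a))).map (fun q => (q.2.1, A q.1 q.2.1 + q.2.2)) =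
      (γ.prod volume).withDensity (outDensity ρ A) := by
  have hA' : Measurable fun q : T × S × (Fin n → Fin a → ℂ) => A q.1 q.2.1 :=
    hA.comp (by fun_prop : Measurable fun q : T × S × (Fin n → Fin a → ℂ) => (q.1, q.2.1))
  refine Measure.ext_of_lintegral _ fun h hh => ?_
  have hmeas : Measurable fun q : T × S × (Fin n → Fin a → ℂ) => (q.2.1, A q.1 q.2.1 + q.2.2) := by
    fun_prop
  have hhA : ∀ s g, Measurable fun z => h (g, A s g + z) := fun s g => by fun_prop
  rw [lintegral_map hh hmeas, lintegral_withDensity_eq_lintegral_mul _ (measurable_outDensity hA) hh,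
    lintegral_prod _ (by fun_prop)]
  have hinner : ∀ s, ∫⁻ q, h (q.1, A s q.1 + q.2) ∂(γ.prod (blockNoise n a)) =
      ∫⁻ q, blockDensity (q.2 - A s q.1) * h q ∂(γ.prod volume) := by
    intro s
    have hAs : Measurable fun g => A s g := hA.comp (by fun_prop : Measurable fun g : S => (s, g))
    rw [lintegral_prod _ (by fun_prop), lintegral_prod _ (by fun_prop)]
    refine lintegral_congr fun g => ?_
    rw [blockNoise_eq_withDensity, lintegral_withDensity_eq_lintegral_mul _ (by fun_prop) (hhA s g),
      ← lintegral_sub_right_eq_self _ (A s g)]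
    simp
  simp_rw [hinner]
  rw [lintegral_lintegral_swap (by
    have h1 : Measurable fun q : T × S × (Fin n → Fin a → ℂ) => h q.2 := hh.comp measurable_snd
    refine Measurable.aemeasurable (?_ : Measurable fun q : T × S × (Fin n → Fin a → ℂ) =>
      blockDensity (q.2.2 - A q.1 q.2.1) * h q.2)
    fun_prop)]
  refine lintegral_congr fun q => ?_
  have := measurable_shift hA q.1 q.2
  rw [lintegral_mul_const _ (by fun_prop)]
  rfl

variable {μ : Measure Ω} {Φ : Ω → T × S × (Fin n → Fin a → ℂ)}

/-- The map `Φ` extracts from the sample space what one group of antennas sees and drops all other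
noise, so that these results apply to every receiver and every number of antennas. -/
theorem map_joint_eq (hA : Measurable fun q : T × S => A q.1 q.2)
    (hΦ : MeasurePreserving Φ μ (ρ.prod (γ.prod (blockNoise n a)))) :
    μ.map (fun ω => ((Φ ω).2.1, A (Φ ω).1 (Φ ω).2.1 + (Φ ω).2.2)) =
      (γ.prod volume).withDensity (outDensity ρ A) := by
  rw [← map_additive_eq_withDensity hA, ← hΦ.map_eq, Measure.map_map _ hΦ.measurable]
  · rfl
  · have hA' : Measurable fun q : T × S × (Fin n → Fin a → ℂ) => A q.1 q.2.1 :=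
      hA.comp (by fun_prop : Measurable fun q : T × S × (Fin n → Fin a → ℂ) => (q.1, q.2.1))
    fun_prop

theorem map_state_eq (hΦ : MeasurePreserving Φ μ (ρ.prod (γ.prod (blockNoise n a)))) :
    μ.map (fun ω => (Φ ω).2.1) = γ := by
  have h1 : (ρ.prod (γ.prod (blockNoise n a))).map (fun q => q.2.1) = γ :=
    (measurePreserving_fst.comp measurePreserving_snd).map_eq
  conv_rhs => rw [← h1, ← hΦ.map_eq, Measure.map_map (by fun_prop) hΦ.measurable]
  rfl

theorem condDensity_ae_eq (hA : Measurable fun q : T × S => A q.1 q.2)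
    (hΦ : MeasurePreserving Φ μ (ρ.prod (γ.prod (blockNoise n a)))) :
    ∀ᵐ ω ∂μ, condDensity μ (fun ω => A (Φ ω).1 (Φ ω).2.1 + (Φ ω).2.2) (fun ω => (Φ ω).2.1)
        ((Φ ω).2.1, A (Φ ω).1 (Φ ω).2.1 + (Φ ω).2.2) =
      outDensity ρ A ((Φ ω).2.1, A (Φ ω).1 (Φ ω).2.1 + (Φ ω).2.2) := by
  have hmeas : Measurable fun ω => ((Φ ω).2.1, A (Φ ω).1 (Φ ω).2.1 + (Φ ω).2.2) := by
    have hA' : Measurable fun ω => A (Φ ω).1 (Φ ω).2.1 :=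
      hA.comp (by have := hΦ.measurable; fun_prop : Measurable fun ω => ((Φ ω).1, (Φ ω).2.1))
    have := hΦ.measurable
    fun_prop
  have h1 := Measure.rnDeriv_withDensity (γ.prod volume) (measurable_outDensity (ρ := ρ) hA)
  -- The Radon-Nikodym derivative is determined only up to null sets of the product measure; these
  -- are null for the joint law of state and output, so the identity may be evaluated at the random
  -- output.
  have h2 := (withDensity_absolutelyContinuous (γ.prod volume) (outDensity ρ A)).ae_le h1
  rw [← map_joint_eq hA hΦ] at h2
  have h3 := ae_of_ae_map hmeas.aemeasurable h2
  filter_upwards [h3] with ω hω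
  rw [condDensity, map_state_eq hΦ]
  exact hω

/-- Jensen's inequality for `exp`: the density is the mean of `exp (-(C + energy))`, hence at least
the exponential of the mean. If the mean energy is infinite there is nothing to prove. -/
theorem neg_log_outDensity_le (hA : Measurable fun q : T × S => A q.1 q.2) (g : S)
    (y : Fin n → Fin a → ℂ) :
    ENNReal.ofReal (-Real.log (outDensity ρ A (g, y)).toReal) ≤
      ENNReal.ofReal (n * a * Real.log Real.pi) + ∫⁻ s, ENNReal.ofReal (energy (y - A s g)) ∂ρ := by
  have hV := measurable_energy.comp (measurable_shift hA g y)
  by_cases hfin : ∫⁻ s, ENNReal.ofReal (energy (y - A s g)) ∂ρ = ∞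
  · simp [hfin]
  have hint : Integrable (fun s => energy (y - A s g)) ρ := by
    refine ⟨hV.aestronglyMeasurable, ?_⟩
    rw [hasFiniteIntegral_iff_ofReal (Filter.Eventually.of_forall fun _ => energy_nonneg _)]
    exact lt_top_iff_ne_top.2 hfin
  have hlogpi : 0 ≤ Real.log Real.pi := Real.log_nonneg (by linarith [Real.pi_gt_three])
  set C : ℝ := n * a * Real.log Real.pi with hC
  have hC0 : 0 ≤ C := by positivity
  rw [← ofReal_integral_eq_lintegral_ofReal hint
    (Filter.Eventually.of_forall fun _ => energy_nonneg _),
    ← ENNReal.ofReal_add hC0 (integral_nonneg fun _ => energy_nonneg _)]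
  refine ENNReal.ofReal_le_ofReal ?_
  have hexpint : Integrable (fun s => Real.exp (-(C + energy (y - A s g)))) ρ := by
    refine Integrable.of_bound (C := 1) (Measurable.aestronglyMeasurable ?_)
      (Filter.Eventually.of_forall fun s => ?_)
    · exact ((hV.const_add C).neg).exp
    · rw [Real.norm_of_nonneg (Real.exp_pos _).le, Real.exp_le_one_iff]
      have := energy_nonneg (y - A s g)
      linarith
  have hout : (outDensity ρ A (g, y)).toReal = ∫ s, Real.exp (-(C + energy (y - A s g))) ∂ρ := by
    rw [integral_eq_lintegral_of_nonneg_ae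
      (Filter.Eventually.of_forall fun s => (Real.exp_pos _).le) hexpint.aestronglyMeasurable]
    simp_rw [outDensity, blockDensity_eq, ← hC]
  have hint' : Integrable (fun s => -(C + energy (y - A s g))) ρ :=
    ((integrable_const C).add hint).neg
  have hjensen := convexOn_exp.map_integral_le (μ := ρ) Real.continuous_exp.continuousOn
    isClosed_univ (Filter.Eventually.of_forall fun s => Set.mem_univ _) hint' hexpint
  have h4 : ∫ s, -(C + energy (y - A s g)) ∂ρ = -(C + ∫ s, energy (y - A s g) ∂ρ) := by
    rw [integral_neg, integral_add (integrable_const _) hint]; simp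
  rw [h4] at hjensen
  have h5 := Real.log_le_log (Real.exp_pos _) hjensen
  rw [Real.log_exp, ← hout] at h5
  linarith

theorem measurable_outDensity_comp (hA : Measurable fun q : T × S => A q.1 q.2) :
    Measurable fun q : T × S × (Fin n → Fin a → ℂ) =>
      Real.log (outDensity ρ A (q.2.1, A q.1 q.2.1 + q.2.2)).toReal := by
  have hA' : Measurable fun q : T × S × (Fin n → Fin a → ℂ) => A q.1 q.2.1 :=
    hA.comp (by fun_prop : Measurable fun q : T × S × (Fin n → Fin a → ℂ) => (q.1, q.2.1))
  have h1 := measurable_outDensity (ρ := ρ) hA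
  exact ((h1.comp (by fun_prop : Measurable fun q : T × S × (Fin n → Fin a → ℂ) =>
    (q.2.1, A q.1 q.2.1 + q.2.2))).ennreal_toReal).log

/-- The density is at most `1`, so its logarithm has one sign, and the lower bound by the mean
energy suffices. -/
theorem integrable_log_outDensity (hA : Measurable fun q : T × S => A q.1 q.2)
    (hfin : ∫⁻ q, ENNReal.ofReal (energy (A q.1 q.2)) ∂(ρ.prod γ) ≠ ∞) :
    Integrable (fun q : T × S × (Fin n → Fin a → ℂ) =>
      Real.log (outDensity ρ A (q.2.1, A q.1 q.2.1 + q.2.2)).toReal)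
      (ρ.prod (γ.prod (blockNoise n a))) := by
  refine ⟨(measurable_outDensity_comp hA).aestronglyMeasurable, ?_⟩
  have hnonpos : ∀ q : S × (Fin n → Fin a → ℂ), Real.log (outDensity ρ A q).toReal ≤ 0 := fun q =>
    Real.log_nonpos ENNReal.toReal_nonneg
      (ENNReal.toReal_le_of_le_ofReal zero_le_one (by simpa using outDensity_le_one q))
  have henorm : ∀ q : S × (Fin n → Fin a → ℂ), ‖Real.log (outDensity ρ A q).toReal‖ₑ =
      ENNReal.ofReal (-Real.log (outDensity ρ A q).toReal) := fun q => by
    rw [← enorm_neg, Real.enorm_of_nonneg (neg_nonneg.2 (hnonpos q))]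
  -- The factors `4`, `4`, `2` come from using `energy_add_le` twice. Here `x` and `y` stand for the
  -- signals of the actual source and of the independent copy.
  have hbound : ∀ (x y z : Fin n → Fin a → ℂ), ENNReal.ofReal (energy (x + z - y)) ≤
      ENNReal.ofReal 4 * ENNReal.ofReal (energy x) + ENNReal.ofReal 4 * ENNReal.ofReal (energy z) +
      ENNReal.ofReal 2 * ENNReal.ofReal (energy y) := by
    intro x y z
    rw [← ENNReal.ofReal_mul (by norm_num), ← ENNReal.ofReal_mul (by norm_num),
      ← ENNReal.ofReal_mul (by norm_num),
      ← ENNReal.ofReal_add (by have := energy_nonneg x; positivity)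
        (by have := energy_nonneg z; positivity),
      ← ENNReal.ofReal_add (by have := energy_nonneg x; have := energy_nonneg z; positivity)
        (by have := energy_nonneg y; positivity)]
    refine ENNReal.ofReal_le_ofReal ?_
    have h1 := energy_add_le (x + z) (-y)
    have h2 := energy_add_le x z
    rw [energy_neg, ← sub_eq_add_neg] at h1
    linarith
  have hAs : ∀ g, Measurable fun s => A s g := fun g =>
    hA.comp (by fun_prop : Measurable fun s : T => (s, g))
  have hA' : Measurable fun q : T × S × (Fin n → Fin a → ℂ) => A q.1 q.2.1 :=
    hA.comp (by fun_prop : Measurable fun q : T × S × (Fin n → Fin a → ℂ) => (q.1, q.2.1))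
  set e : S → ℝ≥0∞ := fun g => ∫⁻ s, ENNReal.ofReal (energy (A s g)) ∂ρ with he
  have hem : Measurable e := Measurable.lintegral_prod_right'
    (f := fun q : S × T => ENNReal.ofReal (energy (A q.2 q.1))) (by
      have : Measurable fun q : S × T => A q.2 q.1 := hA.comp measurable_swap
      fun_prop)
  have hfin' : ∫⁻ g, e g ∂γ ≠ ∞ := by
    rw [he, ← lintegral_prod_symm
      (fun q : T × S => ENNReal.ofReal (energy (A q.1 q.2))) (by fun_prop)]
    exact hfin
  have hpt : ∀ q : T × S × (Fin n → Fin a → ℂ),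
      ‖Real.log (outDensity ρ A (q.2.1, A q.1 q.2.1 + q.2.2)).toReal‖ₑ ≤
      ENNReal.ofReal (n * a * Real.log Real.pi) +
        (ENNReal.ofReal 4 * ENNReal.ofReal (energy (A q.1 q.2.1)) +
          ENNReal.ofReal 4 * ENNReal.ofReal (energy q.2.2) + ENNReal.ofReal 2 * e q.2.1) := by
    intro q
    rw [henorm]
    refine (neg_log_outDensity_le hA _ _).trans ?_
    gcongr
    refine (lintegral_mono fun s => hbound _ _ _).trans ?_
    have := hAs q.2.1
    rw [lintegral_add_left (by fun_prop), lintegral_const_mul _ (by fun_prop)]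
    simp [he]
  have hI1 : ∫⁻ q : T × S × (Fin n → Fin a → ℂ), ENNReal.ofReal (energy (A q.1 q.2.1))
      ∂(ρ.prod (γ.prod (blockNoise n a))) =
      ∫⁻ q, ENNReal.ofReal (energy (A q.1 q.2)) ∂(ρ.prod γ) := by
    have hmp : MeasurePreserving (fun q : T × S × (Fin n → Fin a → ℂ) => (q.1, q.2.1))
        (ρ.prod (γ.prod (blockNoise n a))) (ρ.prod γ) :=
      (MeasurePreserving.id ρ).prod measurePreserving_fst
    exact hmp.lintegral_comp (f := fun q : T × S => ENNReal.ofReal (energy (A q.1 q.2)))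
      (by fun_prop)
  have hI2 : ∫⁻ q : T × S × (Fin n → Fin a → ℂ), ENNReal.ofReal (energy q.2.2)
      ∂(ρ.prod (γ.prod (blockNoise n a))) = n * a := by
    have hmp : MeasurePreserving (fun q : T × S × (Fin n → Fin a → ℂ) => q.2.2)
        (ρ.prod (γ.prod (blockNoise n a))) (blockNoise n a) :=
      measurePreserving_snd.comp measurePreserving_snd
    rw [← lintegral_energy_noise]
    exact hmp.lintegral_comp (f := fun z => ENNReal.ofReal (energy z)) (by fun_prop)
  have hI3 : ∫⁻ q : T × S × (Fin n → Fin a → ℂ), e q.2.1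
      ∂(ρ.prod (γ.prod (blockNoise n a))) = ∫⁻ g, e g ∂γ := by
    have hmp : MeasurePreserving (fun q : T × S × (Fin n → Fin a → ℂ) => q.2.1)
        (ρ.prod (γ.prod (blockNoise n a))) γ :=
      measurePreserving_fst.comp measurePreserving_snd
    exact hmp.lintegral_comp hem
  refine (lintegral_mono hpt).trans_lt ?_
  rw [lintegral_add_left (by fun_prop), lintegral_add_left (by fun_prop),
    lintegral_add_left (by fun_prop), lintegral_const_mul _ (by fun_prop),
    lintegral_const_mul _ (by fun_prop), lintegral_const_mul _ (by fun_prop), hI1, hI2, hI3]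
  simp only [lintegral_const, measure_univ, mul_one]
  have : (n : ℝ≥0∞) * a ≠ ∞ := ENNReal.mul_ne_top (by simp) (by simp)
  simp [lt_top_iff_ne_top, ENNReal.mul_ne_top, hfin, hfin', this]

theorem hasCondDiffEntropy_additive (hA : Measurable fun q : T × S => A q.1 q.2)
    (hΦ : MeasurePreserving Φ μ (ρ.prod (γ.prod (blockNoise n a))))
    (hfin : ∫⁻ q, ENNReal.ofReal (energy (A q.1 q.2)) ∂(ρ.prod γ) ≠ ∞) :
    HasCondDiffEntropy μ (fun ω => A (Φ ω).1 (Φ ω).2.1 + (Φ ω).2.2) (fun ω => (Φ ω).2.1) := by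
  refine ⟨?_, ?_⟩
  · rw [map_joint_eq hA hΦ, map_state_eq hΦ]
    exact withDensity_absolutelyContinuous _ _
  · have h1 := hΦ.integrable_comp_of_integrable (integrable_log_outDensity hA hfin)
    refine h1.congr ?_
    filter_upwards [condDensity_ae_eq hA hΦ] with ω hω
    rw [hω]
    rfl

theorem condDiffEntropy_additive (hA : Measurable fun q : T × S => A q.1 q.2)
    (hΦ : MeasurePreserving Φ μ (ρ.prod (γ.prod (blockNoise n a)))) :
    condDiffEntropy μ (fun ω => A (Φ ω).1 (Φ ω).2.1 + (Φ ω).2.2) (fun ω => (Φ ω).2.1) =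
      -∫ ω, Real.log (outDensity ρ A ((Φ ω).2.1, A (Φ ω).1 (Φ ω).2.1 + (Φ ω).2.2)).toReal ∂μ := by
  rw [condDiffEntropy]
  congr 1
  refine integral_congr_ae ?_
  filter_upwards [condDensity_ae_eq hA hΦ] with ω hω
  rw [hω]

end Additive

/-! ### Jensen's inequality for powers and a tangent bound for the logarithm -/

theorem lintegral_pos_of_forall_pos {T : Type*} [MeasurableSpace T] {ρ : Measure T}
    [IsProbabilityMeasure ρ] {f : T → ℝ≥0∞} (hf : Measurable f) (h : ∀ s, 0 < f s) :
    0 < ∫⁻ s, f s ∂ρ := by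
  rw [lintegral_pos_iff_support hf, Function.support_eq_univ fun s => (h s).ne']
  simp

theorem lintegral_lt_top_of_forall_le {T : Type*} [MeasurableSpace T] {ρ : Measure T}
    [IsProbabilityMeasure ρ] {f : T → ℝ≥0∞} {C : ℝ≥0∞} (hC : C ≠ ∞) (h : ∀ s, f s ≤ C) :
    ∫⁻ s, f s ∂ρ < ∞ :=
  (lintegral_mono h).trans_lt (by simpa using lt_top_iff_ne_top.2 hC)

/-- Jensen's inequality for powers, in logarithmic form. -/
theorem mul_log_lintegral_pow_le {T : Type*} [MeasurableSpace T] {ρ : Measure T}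
    [IsProbabilityMeasure ρ] {f : T → ℝ≥0∞} (hf : Measurable f) {a b : ℕ} (ha : 0 < a) (hab : a ≤ b)
    (hpos : ∀ s, 0 < f s) {C : ℝ≥0∞} (hC : C ≠ ∞) (hle : ∀ s, f s ≤ C) :
    (b : ℝ) / a * Real.log (∫⁻ s, f s ^ a ∂ρ).toReal ≤ Real.log (∫⁻ s, f s ^ b ∂ρ).toReal := by
  have hb : 0 < b := ha.trans_le hab
  have ha' : (0 : ℝ) < a := by exact_mod_cast ha
  have hb' : (0 : ℝ) < b := by exact_mod_cast hb
  have hpow : ∀ d : ℕ, 0 < (∫⁻ s, f s ^ d ∂ρ).toReal := fun d =>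
    ENNReal.toReal_pos (lintegral_pos_of_forall_pos (hf.pow_const d)
      fun s => ENNReal.pow_pos (hpos s) d).ne'
      (lintegral_lt_top_of_forall_le (C := C ^ d) (ENNReal.pow_ne_top hC)
        fun s => by gcongr; exact hle s).ne
  -- On a probability space the `L^p` norms increase with the exponent.
  have h := eLpNorm'_le_eLpNorm'_of_exponent_le (p := (a : ℝ)) (q := (b : ℝ)) ha'
    (by exact_mod_cast hab) ρ (f := f) hf.aestronglyMeasurable
  simp only [eLpNorm', enorm_eq_self, ENNReal.rpow_natCast] at h
  have hfin : (∫⁻ s, f s ^ b ∂ρ) ^ (1 / (b : ℝ)) ≠ ∞ :=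
    ENNReal.rpow_ne_top_of_nonneg (by positivity) (ENNReal.toReal_pos_iff.1 (hpow b)).2.ne
  have h2 := ENNReal.toReal_mono hfin h
  rw [← ENNReal.toReal_rpow, ← ENNReal.toReal_rpow] at h2
  have h3 := Real.log_le_log (Real.rpow_pos_of_pos (hpow a) _) h2
  rw [Real.log_rpow (hpow a), Real.log_rpow (hpow b)] at h3
  calc (b : ℝ) / a * Real.log (∫⁻ s, f s ^ a ∂ρ).toReal
      = b * (1 / a * Real.log (∫⁻ s, f s ^ a ∂ρ).toReal) := by ring
    _ ≤ b * (1 / b * Real.log (∫⁻ s, f s ^ b ∂ρ).toReal) := by gcongr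
    _ = _ := by field_simp

/-- A pointwise form of Gibbs' inequality: if `x / y` has mean at most `1`, the last term has
nonpositive mean. Working pointwise, no integrability of the intermediate logarithms is needed. -/
theorem log_le_log_add_div_sub_one {x y : ℝ} (hx : 0 < x) (hy : 0 < y) :
    Real.log x ≤ Real.log y + (x / y - 1) := by
  have h := Real.log_le_sub_one_of_pos (div_pos hx hy)
  rw [Real.log_div hx.ne' hy.ne'] at h
  linarith

/-! ### The heavy-tailed kernel on blocks and its weight -/

section Kernels

variable {n a : ℕ}

/-- A heavy-tailed kernel that dominates the probability of alignment. -/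
noncomputable def tailKernel (z : Fin n → Fin a → ℂ) : ℝ≥0∞ :=
  ∏ t, ∏ r, ENNReal.ofReal ((1 + ‖z t r‖ ^ 2)⁻¹)

/-- A slowly decaying weight that makes `tailKernel` integrable. -/
noncomputable def tailWeight (δ : ℝ) (z : Fin n → Fin a → ℂ) : ℝ≥0∞ :=
  ∏ t, ∏ r, ENNReal.ofReal ((1 + ‖z t r‖ ^ 2) ^ (-δ))

@[fun_prop]
theorem measurable_tailKernel : Measurable (tailKernel : (Fin n → Fin a → ℂ) → ℝ≥0∞) := by
  unfold tailKernel; fun_prop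

@[fun_prop]
theorem measurable_tailWeight (δ : ℝ) :
    Measurable (tailWeight δ : (Fin n → Fin a → ℂ) → ℝ≥0∞) := by
  unfold tailWeight; fun_prop

theorem tailKernel_pos (z : Fin n → Fin a → ℂ) : 0 < tailKernel z :=
  pos_iff_ne_zero.2 <| Finset.prod_ne_zero_iff.2 fun _ _ => Finset.prod_ne_zero_iff.2 fun _ _ =>
    (ENNReal.ofReal_pos.2 (by positivity)).ne'

theorem tailKernel_le_one (z : Fin n → Fin a → ℂ) : tailKernel z ≤ 1 :=
  Finset.prod_le_one' fun t _ => Finset.prod_le_one' fun r _ => by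
    rw [← ENNReal.ofReal_one]
    exact ENNReal.ofReal_le_ofReal (inv_le_one_of_one_le₀ (by nlinarith [sq_nonneg ‖z t r‖]))

theorem tailWeight_eq (δ : ℝ) (z : Fin n → Fin a → ℂ) :
    tailWeight δ z =
      ENNReal.ofReal (Real.exp (-(δ * ∑ t, ∑ r, Real.log (1 + ‖z t r‖ ^ 2)))) := by
  unfold tailWeight
  have h : ∀ t r, (1 + ‖z t r‖ ^ 2) ^ (-δ) = Real.exp (-(δ * Real.log (1 + ‖z t r‖ ^ 2))) := by
    intro t r
    rw [Real.rpow_def_of_pos (by positivity)]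
    ring_nf
  simp_rw [h, ← ENNReal.ofReal_prod_of_nonneg fun i (_ : i ∈ Finset.univ) => (Real.exp_pos _).le,
    ← Real.exp_sum]
  rw [← ENNReal.ofReal_prod_of_nonneg fun i _ => (Real.exp_pos _).le, ← Real.exp_sum]
  simp [Finset.mul_sum]

theorem lintegral_tailKernel_mul_tailWeight_le {δ : ℝ} (hδ : 0 < δ) (x : Fin n → Fin a → ℂ) :
    ∫⁻ y, tailKernel (y - x) * tailWeight δ y ≤ ENNReal.ofReal (2 * Real.pi / δ) ^ (n * a) := by
  have h1 : ∀ y : Fin n → Fin a → ℂ, tailKernel (y - x) * tailWeight δ y =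
      ∏ t, ∏ r, ENNReal.ofReal ((1 + ‖y t r - x t r‖ ^ 2)⁻¹ * (1 + ‖y t r‖ ^ 2) ^ (-δ)) := by
    intro y
    simp only [tailKernel, tailWeight, ← Finset.prod_mul_distrib, Pi.sub_apply]
    refine Finset.prod_congr rfl fun t _ => Finset.prod_congr rfl fun r _ => ?_
    rw [ENNReal.ofReal_mul (by positivity)]
  simp_rw [h1]
  rw [volume_pi, lintegral_pi_prod volume (fun t (y : Fin a → ℂ) => ∏ r, ENNReal.ofReal
    ((1 + ‖y r - x t r‖ ^ 2)⁻¹ * (1 + ‖y r‖ ^ 2) ^ (-δ))) fun t => by fun_prop]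
  calc _ ≤ ∏ _t : Fin n, ENNReal.ofReal (2 * Real.pi / δ) ^ a := by
        refine Finset.prod_le_prod' fun t _ => ?_
        rw [volume_pi, lintegral_pi_prod volume (fun r (y : ℂ) => ENNReal.ofReal
          ((1 + ‖y - x t r‖ ^ 2)⁻¹ * (1 + ‖y‖ ^ 2) ^ (-δ))) fun r => by fun_prop]
        calc _ ≤ ∏ _r : Fin a, ENNReal.ofReal (2 * Real.pi / δ) :=
              Finset.prod_le_prod' fun r _ => lintegral_kernel_mul_weight_le hδ _
          _ = _ := by simp
    _ = _ := by simp [← pow_mul, mul_comm]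

end Kernels

/-! ### Comparison of the heavy-tailed density with the true density -/

section Comparison

variable {T S : Type*} [MeasurableSpace T] {n a : ℕ}

/-- The analogue of `outDensity` for the heavy-tailed kernel. -/
noncomputable def tailDensity (ρ : Measure T) (A : T → S → Fin n → Fin a → ℂ)
    (q : S × (Fin n → Fin a → ℂ)) : ℝ≥0∞ :=
  ∫⁻ s, tailKernel (q.2 - A s q.1) ∂ρ

variable {ρ : Measure T} [IsProbabilityMeasure ρ] {A : T → S → Fin n → Fin a → ℂ}

theorem tailDensity_le_one (q : S × (Fin n → Fin a → ℂ)) : tailDensity ρ A q ≤ 1 := by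
  calc tailDensity ρ A q ≤ ∫⁻ _, 1 ∂ρ := lintegral_mono fun s => tailKernel_le_one _
    _ = 1 := by simp

variable [MeasurableSpace S] {γ : Measure S} [IsProbabilityMeasure γ]

theorem tailDensity_pos (hA : Measurable fun q : T × S => A q.1 q.2)
    (q : S × (Fin n → Fin a → ℂ)) : 0 < tailDensity ρ A q := by
  have := measurable_shift hA q.1 q.2
  exact lintegral_pos_of_forall_pos (by fun_prop) fun s => tailKernel_pos _

theorem measurable_tailDensity (hA : Measurable fun q : T × S => A q.1 q.2) :
    Measurable (tailDensity ρ A) := by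
  refine Measurable.lintegral_prod_right'
    (f := fun q : (S × (Fin n → Fin a → ℂ)) × T => tailKernel (q.1.2 - A q.2 q.1.1)) ?_
  have h1 : Measurable fun q : (S × (Fin n → Fin a → ℂ)) × T => A q.2 q.1.1 :=
    hA.comp (by fun_prop : Measurable fun q : (S × (Fin n → Fin a → ℂ)) × T => (q.2, q.1.1))
  fun_prop

/-- The ratio of the normalised weighted heavy-tailed density to the true density. -/
noncomputable def tailRatio (ρ : Measure T) (A : T → S → Fin n → Fin a → ℂ) (δ : ℝ)
    (q : S × (Fin n → Fin a → ℂ)) : ℝ≥0∞ :=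
  tailDensity ρ A q * tailWeight δ q.2 /
    (ENNReal.ofReal (2 * Real.pi / δ) ^ (n * a) * outDensity ρ A q)

theorem measurable_tailRatio (hA : Measurable fun q : T × S => A q.1 q.2) (δ : ℝ) :
    Measurable (tailRatio ρ A δ) := by
  have h1 := measurable_tailDensity (ρ := ρ) hA
  have h2 := measurable_outDensity (ρ := ρ) hA
  unfold tailRatio
  fun_prop

/-- Integrating against the law of the output cancels the denominator `outDensity`. What is left is
the mass of the weighted kernel density, at most `M` for each `g`, because the kernel bound is
uniform in the centre `A s g`. -/
theorem lintegral_tailRatio_le (hA : Measurable fun q : T × S => A q.1 q.2) {δ : ℝ} (hδ : 0 < δ) :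
    ∫⁻ q : T × S × (Fin n → Fin a → ℂ), tailRatio ρ A δ (q.2.1, A q.1 q.2.1 + q.2.2)
      ∂(ρ.prod (γ.prod (blockNoise n a))) ≤ 1 := by
  have hA' : Measurable fun q : T × S × (Fin n → Fin a → ℂ) => A q.1 q.2.1 :=
    hA.comp (by fun_prop : Measurable fun q : T × S × (Fin n → Fin a → ℂ) => (q.1, q.2.1))
  have hR := measurable_tailRatio (ρ := ρ) hA δ
  have htd := measurable_tailDensity (ρ := ρ) hA
  set M : ℝ≥0∞ := ENNReal.ofReal (2 * Real.pi / δ) ^ (n * a) with hM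
  have hM0 : M ≠ 0 := pow_ne_zero _ (ENNReal.ofReal_pos.2 (by positivity)).ne'
  have hMtop : M ≠ ∞ := ENNReal.pow_ne_top ENNReal.ofReal_ne_top
  rw [← lintegral_map (f := tailRatio ρ A δ) (g := fun q : T × S × (Fin n → Fin a → ℂ) =>
      (q.2.1, A q.1 q.2.1 + q.2.2)) hR (by fun_prop),
    map_additive_eq_withDensity hA,
    lintegral_withDensity_eq_lintegral_mul _ (measurable_outDensity hA) hR]
  have hpt : ∀ q, (outDensity ρ A * tailRatio ρ A δ) q =
      M⁻¹ * (tailDensity ρ A q * tailWeight δ q.2) := by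
    intro q
    have h0 := (outDensity_pos (ρ := ρ) hA q).ne'
    have htop := ((outDensity_le_one (ρ := ρ) (A := A) q).trans_lt ENNReal.one_lt_top).ne
    rw [Pi.mul_apply, tailRatio, ← hM, div_eq_mul_inv, ENNReal.mul_inv (Or.inl hM0) (Or.inl hMtop)]
    calc _ = (outDensity ρ A q * (outDensity ρ A q)⁻¹) *
          (M⁻¹ * (tailDensity ρ A q * tailWeight δ q.2)) := by ring
      _ = _ := by rw [ENNReal.mul_inv_cancel h0 htop, one_mul]
  simp_rw [hpt]
  rw [lintegral_const_mul _ (by fun_prop), lintegral_prod _ (by fun_prop)]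
  have hg : ∀ g, ∫⁻ y, tailDensity ρ A (g, y) * tailWeight δ y ≤ M := by
    intro g
    have hAg : Measurable fun q : (Fin n → Fin a → ℂ) × T => A q.2 g :=
      hA.comp (by fun_prop : Measurable fun q : (Fin n → Fin a → ℂ) × T => (q.2, g))
    have h1 : ∀ y, tailDensity ρ A (g, y) * tailWeight δ y =
        ∫⁻ s, tailKernel (y - A s g) * tailWeight δ y ∂ρ := by
      intro y
      have := measurable_shift hA g y
      rw [lintegral_mul_const _ (by fun_prop)]
      rfl
    simp_rw [h1]
    rw [lintegral_lintegral_swap (Measurable.aemeasurable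
      (by fun_prop : Measurable fun q : (Fin n → Fin a → ℂ) × T =>
        tailKernel (q.1 - A q.2 g) * tailWeight δ q.1))]
    calc _ ≤ ∫⁻ _, M ∂ρ :=
          lintegral_mono fun s => lintegral_tailKernel_mul_tailWeight_le hδ _
      _ = M := by simp
  calc _ ≤ M⁻¹ * ∫⁻ _, M ∂γ := by gcongr with g; exact hg g
    _ = 1 := by simp [ENNReal.inv_mul_cancel hM0 hMtop]

/-- The tangent bound applied to the weighted heavy-tailed density and `M` times the true one; the
weight and `M` supply the two correction terms. -/
theorem log_tailDensity_le (hA : Measurable fun q : T × S => A q.1 q.2) {δ : ℝ} (hδ : 0 < δ)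
    (q : S × (Fin n → Fin a → ℂ)) :
    Real.log (tailDensity ρ A q).toReal ≤ Real.log (outDensity ρ A q).toReal +
      ((tailRatio ρ A δ q).toReal - 1) + δ * (∑ t, ∑ r, Real.log (1 + ‖q.2 t r‖ ^ 2)) +
      n * a * Real.log (2 * Real.pi / δ) := by
  have hf := outDensity_toReal_pos (ρ := ρ) hA q
  have hq : 0 < (tailDensity ρ A q).toReal := ENNReal.toReal_pos (tailDensity_pos hA q).ne'
    ((tailDensity_le_one q).trans_lt ENNReal.one_lt_top).ne
  have hc : 0 < 2 * Real.pi / δ := by positivity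
  have hR : (tailRatio ρ A δ q).toReal = (tailDensity ρ A q).toReal *
      Real.exp (-(δ * ∑ t, ∑ r, Real.log (1 + ‖q.2 t r‖ ^ 2))) /
      ((2 * Real.pi / δ) ^ (n * a) * (outDensity ρ A q).toReal) := by
    rw [tailRatio, tailWeight_eq, ENNReal.toReal_div, ENNReal.toReal_mul, ENNReal.toReal_mul,
      ENNReal.toReal_pow, ENNReal.toReal_ofReal hc.le, ENNReal.toReal_ofReal (Real.exp_pos _).le]
  rw [hR]
  have h := log_le_log_add_div_sub_one (mul_pos hq (Real.exp_pos
    (-(δ * ∑ t, ∑ r, Real.log (1 + ‖q.2 t r‖ ^ 2))))) (mul_pos (pow_pos hc (n * a)) hf)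
  rw [Real.log_mul hq.ne' (Real.exp_pos _).ne', Real.log_exp,
    Real.log_mul (pow_pos hc _).ne' hf.ne', Real.log_pow] at h
  push_cast at h
  linarith

end Comparison

/-! Alignment at the receiver whose channel is unknown to the transmitter. -/

section Spread

variable {T S : Type*} [MeasurableSpace T] {m n : ℕ}

/-- The product of the single-slot bounds for the density of alignment of `x` and `y` at one
antenna. -/
noncomputable def alignment (F : ℝ) (x y : Fin n → Fin m → ℂ) : ℝ≥0∞ :=
  ∏ t, ENNReal.ofReal ((1 + F) / (1 + ‖x t - y t‖ ^ 2))

theorem measurable_alignment {α : Type*} [MeasurableSpace α] (F : ℝ)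
    {f g : α → Fin n → Fin m → ℂ} (hf : Measurable f) (hg : Measurable g) :
    Measurable fun q => alignment F (f q) (g q) := by
  unfold alignment; fun_prop

theorem alignment_pos {F : ℝ} (hF : 0 < F) (x y : Fin n → Fin m → ℂ) : 0 < alignment F x y :=
  pos_iff_ne_zero.2 <| Finset.prod_ne_zero_iff.2 fun _ _ =>
    (ENNReal.ofReal_pos.2 (by positivity)).ne'

theorem alignment_le {F : ℝ} (hF : 0 < F) (x y : Fin n → Fin m → ℂ) :
    alignment F x y ≤ ENNReal.ofReal (1 + F) ^ n := by
  calc alignment F x y ≤ ∏ _t : Fin n, ENNReal.ofReal (1 + F) :=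
        Finset.prod_le_prod' fun t _ => ENNReal.ofReal_le_ofReal
          (div_le_self (by positivity) (by nlinarith [sq_nonneg ‖x t - y t‖]))
    _ = _ := by simp

/-- The mean of the `a`-th power of the alignment with an independent codeword. -/
noncomputable def spread (ρ : Measure T) (X : T → S → Fin n → Fin m → ℂ) (F : ℝ) (a : ℕ)
    (s : T) (g : S) : ℝ≥0∞ :=
  ∫⁻ s', alignment F (X s g) (X s' g) ^ a ∂ρ

variable {ρ : Measure T} [IsProbabilityMeasure ρ] {X : T → S → Fin n → Fin m → ℂ} {F : ℝ}

theorem spread_lt_top (hF : 0 < F) (a : ℕ) (s : T) (g : S) : spread ρ X F a s g < ∞ :=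
  lintegral_lt_top_of_forall_le (C := (ENNReal.ofReal (1 + F) ^ n) ^ a)
    (ENNReal.pow_ne_top (ENNReal.pow_ne_top ENNReal.ofReal_ne_top))
    fun _ => by gcongr; exact alignment_le hF _ _

variable [MeasurableSpace S] {γ : Measure S} [IsProbabilityMeasure γ]

theorem measurable_alignment_right (hX : Measurable fun q : T × S => X q.1 q.2) (s : T) (g : S) :
    Measurable fun s' => alignment F (X s g) (X s' g) := by
  have h : Measurable fun s' => X s' g := hX.comp (by fun_prop : Measurable fun s' : T => (s', g))
  exact measurable_alignment F measurable_const h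

theorem spread_pos (hX : Measurable fun q : T × S => X q.1 q.2) (hF : 0 < F) (a : ℕ) (s : T)
    (g : S) : 0 < spread ρ X F a s g :=
  lintegral_pos_of_forall_pos ((measurable_alignment_right hX s g).pow_const a)
    fun _ => ENNReal.pow_pos (alignment_pos hF _ _) a

theorem measurable_spread (hX : Measurable fun q : T × S => X q.1 q.2) (F : ℝ) (a : ℕ) :
    Measurable fun q : T × S => spread ρ X F a q.1 q.2 := by
  refine Measurable.lintegral_prod_right'
    (f := fun q : (T × S) × T => alignment F (X q.1.1 q.1.2) (X q.2 q.1.2) ^ a) ?_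
  have h1 : Measurable fun q : (T × S) × T => X q.1.1 q.1.2 := hX.comp measurable_fst
  have h2 : Measurable fun q : (T × S) × T => X q.2 q.1.2 :=
    hX.comp (by fun_prop : Measurable fun q : (T × S) × T => (q.2, q.1.2))
  exact (measurable_alignment F h1 h2).pow_const a

/-- The alignment bound is the same at every antenna, so the number of antennas enters `spread` only
as an exponent, and passing from `a` to `b` antennas is Jensen's inequality. -/
theorem mul_log_spread_le (hX : Measurable fun q : T × S => X q.1 q.2) (hF : 0 < F) {a b : ℕ}
    (ha : 0 < a) (hab : a ≤ b) (s : T) (g : S) :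
    (b : ℝ) / a * Real.log (spread ρ X F a s g).toReal ≤ Real.log (spread ρ X F b s g).toReal := by
  have hle : ∀ s', alignment F (X s g) (X s' g) ≤ ENNReal.ofReal (1 + F) ^ n :=
    fun _ => alignment_le hF _ _
  have htop : ENNReal.ofReal (1 + F) ^ n ≠ ∞ := ENNReal.pow_ne_top ENNReal.ofReal_ne_top
  have hpos : ∀ s', 0 < alignment F (X s g) (X s' g) := fun _ => alignment_pos hF _ _
  unfold spread
  have hm : Measurable fun s' => alignment F (X s g) (X s' g) := measurable_alignment_right hX s g
  have := mul_log_lintegral_pow_le (ρ := ρ) hm ha hab hpos htop hle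
  exact this

theorem measurable_blockDensity_diff {α : Type*} [MeasurableSpace α] {a : ℕ}
    {g : α → Fin n → Fin a → Fin m → ℂ} {x y : α → Fin n → Fin m → ℂ} {z : α → Fin n → Fin a → ℂ}
    (hg : Measurable g) (hx : Measurable x) (hy : Measurable y) (hz : Measurable z) :
    Measurable fun q => blockDensity (fun t r =>
      (∑ i, g q t r i * (x q t i - y q t i)) + z q t r) := by
  unfold blockDensity
  fun_prop

theorem measurable_div_spread (hX : Measurable fun q : T × S => X q.1 q.2) (F : ℝ) (a : ℕ)
    (s : T) :
    Measurable fun q : S × (Fin n → Fin a → Fin m → ℂ) => ∫⁻ z : Fin n → Fin a → ℂ,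
        (∫⁻ s', blockDensity (fun (t : Fin n) (r : Fin a) =>
          (∑ i, q.2 t r i * (X s q.1 t i - X s' q.1 t i)) + z t r) ∂ρ) / spread ρ X F a s q.1
        ∂(blockNoise n a) := by
  have hspread : Measurable fun g => spread ρ X F a s g := by
    have h1 := (measurable_spread (ρ := ρ) hX F a).comp (measurable_prodMk_left (x := s))
    exact h1
  have hB : Measurable fun q : ((S × (Fin n → Fin a → Fin m → ℂ)) × (Fin n → Fin a → ℂ)) × T =>
      blockDensity (fun t r =>
        (∑ i, q.1.1.2 t r i * (X s q.1.1.1 t i - X q.2 q.1.1.1 t i)) + q.1.2 t r) :=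
    measurable_blockDensity_diff (by fun_prop)
      (hX.comp (by fun_prop :
        Measurable fun q : ((S × (Fin n → Fin a → Fin m → ℂ)) × (Fin n → Fin a → ℂ)) × T =>
          (s, q.1.1.1)))
      (hX.comp (by fun_prop :
        Measurable fun q : ((S × (Fin n → Fin a → Fin m → ℂ)) × (Fin n → Fin a → ℂ)) × T =>
          (q.2, q.1.1.1))) (by fun_prop)
  have h1 : Measurable fun q : (S × (Fin n → Fin a → Fin m → ℂ)) × (Fin n → Fin a → ℂ) =>
      spread ρ X F a s q.1.1 :=
    hspread.comp (by fun_prop :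
      Measurable fun q : (S × (Fin n → Fin a → Fin m → ℂ)) × (Fin n → Fin a → ℂ) => q.1.1)
  have h2 := (Measurable.lintegral_prod_right' (ν := ρ) hB).div h1
  exact h2.lintegral_prod_right'

/-- Neither the inputs nor `spread` involve the second component `q.2`. Integrating over `q.2` and
the noise first, with `q.1` fixed, turns the numerator into at most `spread`, which cancels the
denominator. -/
theorem lintegral_div_spread_le {dmax : ℝ} {law : Measure ℂ} (h : IsChannelLaw dmax F law)
    (hX : Measurable fun q : T × S => X q.1 q.2) (a : ℕ) (s : T) :
    ∫⁻ q : S × (Fin n → Fin a → Fin m → ℂ), ∫⁻ z : Fin n → Fin a → ℂ,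
        (∫⁻ s', blockDensity (fun (t : Fin n) (r : Fin a) =>
          (∑ i, q.2 t r i * (X s q.1 t i - X s' q.1 t i)) + z t r) ∂ρ) / spread ρ X F a s q.1
        ∂(blockNoise n a) ∂(γ.prod (blockChannel m n a law)) ≤ 1 := by
  have := h.isProbabilityMeasure
  have hspread : Measurable fun g => spread ρ X F a s g := by
    have h1 := (measurable_spread (ρ := ρ) hX F a).comp (measurable_prodMk_left (x := s))
    exact h1
  have hB : Measurable fun q : ((S × (Fin n → Fin a → Fin m → ℂ)) × T) × (Fin n → Fin a → ℂ) =>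
      blockDensity (fun t r =>
        (∑ i, q.1.1.2 t r i * (X s q.1.1.1 t i - X q.1.2 q.1.1.1 t i)) + q.2 t r) :=
    measurable_blockDensity_diff (by fun_prop)
      (hX.comp (by fun_prop :
        Measurable fun q : ((S × (Fin n → Fin a → Fin m → ℂ)) × T) × (Fin n → Fin a → ℂ) =>
          (s, q.1.1.1)))
      (hX.comp (by fun_prop :
        Measurable fun q : ((S × (Fin n → Fin a → Fin m → ℂ)) × T) × (Fin n → Fin a → ℂ) =>
          (q.1.2, q.1.1.1))) (by fun_prop)
  set J : (S × (Fin n → Fin a → Fin m → ℂ)) × T → ℝ≥0∞ := fun q =>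
    ∫⁻ z, blockDensity (fun t r =>
      (∑ i, q.1.2 t r i * (X s q.1.1 t i - X q.2 q.1.1 t i)) + z t r) ∂(blockNoise n a) with hJ
  have hJm : Measurable J := hB.lintegral_prod_right'
  have hK : Measurable fun q : S × (Fin n → Fin a → Fin m → ℂ) => ∫⁻ s', J (q, s') ∂ρ :=
    hJm.lintegral_prod_right'
  have hinner : ∀ q : S × (Fin n → Fin a → Fin m → ℂ), ∫⁻ z,
      (∫⁻ s', blockDensity (fun t r =>
        (∑ i, q.2 t r i * (X s q.1 t i - X s' q.1 t i)) + z t r) ∂ρ) / spread ρ X F a s q.1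
      ∂(blockNoise n a) = (∫⁻ s', J (q, s') ∂ρ) * (spread ρ X F a s q.1)⁻¹ := by
    intro q
    have hBq : Measurable fun w : (Fin n → Fin a → ℂ) × T => blockDensity (fun t r =>
        (∑ i, q.2 t r i * (X s q.1 t i - X w.2 q.1 t i)) + w.1 t r) := by
      have h1 := hB.comp
        (by fun_prop : Measurable fun w : (Fin n → Fin a → ℂ) × T => ((q, w.2), w.1))
      exact h1
    simp_rw [div_eq_mul_inv]
    rw [lintegral_mul_const _ hBq.lintegral_prod_right', lintegral_lintegral_swap hBq.aemeasurable]
  simp_rw [hinner]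
  have hspread' : Measurable fun q : S × (Fin n → Fin a → Fin m → ℂ) => spread ρ X F a s q.1 :=
    hspread.comp measurable_fst
  rw [lintegral_prod _ (by fun_prop)]
  calc _ ≤ ∫⁻ _, 1 ∂γ := by
        refine lintegral_mono fun g => ?_
        have hJg : Measurable fun w : (Fin n → Fin a → Fin m → ℂ) × T => J ((g, w.1), w.2) := by
          have h1 := hJm.comp (by fun_prop : Measurable
            fun w : (Fin n → Fin a → Fin m → ℂ) × T => ((g, w.1), w.2))
          exact h1
        have hJg' : Measurable fun ge : Fin n → Fin a → Fin m → ℂ => ∫⁻ s', J ((g, ge), s') ∂ρ :=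
          hJg.lintegral_prod_right'
        dsimp only
        rw [lintegral_mul_const _ hJg', lintegral_lintegral_swap hJg.aemeasurable]
        have hle : ∫⁻ s', ∫⁻ ge, J ((g, ge), s') ∂(blockChannel m n a law) ∂ρ ≤
            spread ρ X F a s g := by
          refine lintegral_mono fun s' => ?_
          refine (lintegral_blockDensity_le h a fun t i => X s g t i - X s' g t i).trans_eq ?_
          rw [alignment, ← Finset.prod_pow]
          rfl
        calc _ ≤ spread ρ X F a s g * (spread ρ X F a s g)⁻¹ := by gcongr
          _ ≤ 1 := ENNReal.mul_inv_le_one _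
    _ = 1 := by simp

end Spread

/-! Pointwise comparison of the two densities. -/

section Pointwise

variable {m n a : ℕ}

/-- Here `d` is the input difference, `w` the noiseless output difference, `z` the noise and `v` the
noisy difference. The factor `1 + z ^ 2` is replaced by `exp (z ^ 2)` so that the product over a
block becomes the exponential of the noise energy. -/
theorem slot_alignment_le {F c d w z v : ℝ} (hF : 0 < F) (hw0 : 0 ≤ w)
    (hw : w ≤ c * d) (hv0 : 0 ≤ v) (hv : v ≤ w + z) :
    (1 + F) / (1 + d ^ 2) ≤ 2 * (1 + F) * (1 + c ^ 2) * Real.exp (z ^ 2) * (1 + v ^ 2)⁻¹ := by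
  have hexp : 1 + z ^ 2 ≤ Real.exp (z ^ 2) := by linarith [Real.add_one_le_exp (z ^ 2)]
  have hw2 : w ^ 2 ≤ c ^ 2 * d ^ 2 := by
    rw [← mul_pow]; exact pow_le_pow_left₀ hw0 hw 2
  have hv2 : v ^ 2 ≤ 2 * w ^ 2 + 2 * z ^ 2 := by
    have := pow_le_pow_left₀ hv0 hv 2
    nlinarith [sq_nonneg (w - z)]
  have key : 1 + v ^ 2 ≤ 2 * (1 + c ^ 2) * Real.exp (z ^ 2) * (1 + d ^ 2) := by
    calc 1 + v ^ 2 ≤ 2 * ((1 + c ^ 2) * (1 + d ^ 2)) * (1 + z ^ 2) := by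
          nlinarith [sq_nonneg c, sq_nonneg d, sq_nonneg z, mul_nonneg (sq_nonneg c) (sq_nonneg d),
            mul_nonneg (mul_nonneg (sq_nonneg c) (sq_nonneg d)) (sq_nonneg z),
            mul_nonneg (sq_nonneg c) (sq_nonneg z), mul_nonneg (sq_nonneg d) (sq_nonneg z)]
      _ ≤ 2 * ((1 + c ^ 2) * (1 + d ^ 2)) * Real.exp (z ^ 2) := by gcongr
      _ = _ := by ring
  rw [← div_eq_mul_inv, div_le_div_iff₀ (by positivity) (by positivity)]
  calc (1 + F) * (1 + v ^ 2)
      ≤ (1 + F) * (2 * (1 + c ^ 2) * Real.exp (z ^ 2) * (1 + d ^ 2)) := by gcongr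
    _ = _ := by ring

theorem alignment_pow_le {F c : ℝ} (hF : 0 < F) {x y : Fin n → Fin m → ℂ}
    {u v : Fin n → Fin a → ℂ} (h : ∀ t r, ‖u t r - v t r‖ ≤ c * ‖x t - y t‖)
    (z : Fin n → Fin a → ℂ) :
    alignment F x y ^ a ≤ ENNReal.ofReal
      ((2 * (1 + F) * (1 + c ^ 2)) ^ (n * a) * Real.exp (energy z)) * tailKernel (u + z - v) := by
  have hK : ENNReal.ofReal ((2 * (1 + F) * (1 + c ^ 2)) ^ (n * a) * Real.exp (energy z)) =
      ∏ t, ∏ r, ENNReal.ofReal (2 * (1 + F) * (1 + c ^ 2) * Real.exp (‖z t r‖ ^ 2)) := by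
    have h0 : ∀ u : ℂ, 0 ≤ 2 * (1 + F) * (1 + c ^ 2) * Real.exp (‖u‖ ^ 2) := fun u => by
      positivity
    simp_rw [← ENNReal.ofReal_prod_of_nonneg fun i (_ : i ∈ Finset.univ) => h0 _]
    rw [← ENNReal.ofReal_prod_of_nonneg fun i _ => Finset.prod_nonneg fun j _ => by positivity]
    congr 1
    simp [Finset.prod_mul_distrib, energy, Real.exp_sum, ← pow_mul, mul_pow, mul_comm a n]
  have hL : alignment F x y ^ a = ∏ t, ∏ _r : Fin a,
      ENNReal.ofReal ((1 + F) / (1 + ‖x t - y t‖ ^ 2)) := by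
    simp [alignment, Finset.prod_pow]
  rw [hK, hL, tailKernel]
  simp_rw [← Finset.prod_mul_distrib]
  refine Finset.prod_le_prod' fun t _ => Finset.prod_le_prod' fun r _ => ?_
  rw [← ENNReal.ofReal_mul (by positivity)]
  refine ENNReal.ofReal_le_ofReal
    (slot_alignment_le hF (norm_nonneg _) (h t r) (norm_nonneg _) ?_)
  have : (u + z - v) t r = (u t r - v t r) + z t r := by
    simp only [Pi.add_apply, Pi.sub_apply]; ring
  rw [this]
  exact norm_add_le _ _

variable {T S S₀ : Type*} [MeasurableSpace T] [MeasurableSpace S] [MeasurableSpace S₀]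
  {ρ : Measure T} [IsProbabilityMeasure ρ]

/-- The factor in `alignment_pow_le` depends on the noise but not on `s'`. It therefore leaves the
mean over `s'`, and the remaining mean is `tailDensity` at the actual output. -/
theorem log_spread_le {X : T → S₀ → Fin n → Fin m → ℂ} {A : T → S → Fin n → Fin a → ℂ}
    (hX : Measurable fun q : T × S₀ => X q.1 q.2) (hA : Measurable fun q : T × S => A q.1 q.2)
    {F c : ℝ} (hF : 0 < F) {s : T} {g₀ : S₀} {g : S}
    (h : ∀ s' t r, ‖A s g t r - A s' g t r‖ ≤ c * ‖X s g₀ t - X s' g₀ t‖)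
    (z : Fin n → Fin a → ℂ) :
    Real.log (spread ρ X F a s g₀).toReal ≤ n * a * Real.log (2 * (1 + F) * (1 + c ^ 2)) +
      energy z + Real.log (tailDensity ρ A (g, A s g + z)).toReal := by
  have hq : 0 < (tailDensity ρ A (g, A s g + z)).toReal :=
    ENNReal.toReal_pos (tailDensity_pos hA _).ne'
      ((tailDensity_le_one _).trans_lt ENNReal.one_lt_top).ne
  have hL : 0 < (spread ρ X F a s g₀).toReal :=
    ENNReal.toReal_pos (spread_pos hX hF a s g₀).ne' (spread_lt_top hF a s g₀).ne
  have hK : 0 < 2 * (1 + F) * (1 + c ^ 2) := by positivity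
  have hle : spread ρ X F a s g₀ ≤ ENNReal.ofReal
      ((2 * (1 + F) * (1 + c ^ 2)) ^ (n * a) * Real.exp (energy z)) *
        tailDensity ρ A (g, A s g + z) := by
    have := measurable_shift hA g (A s g + z)
    rw [tailDensity, ← lintegral_const_mul _ (by fun_prop)]
    exact lintegral_mono fun s' => alignment_pow_le hF (h s') z
  have h2 := ENNReal.toReal_mono (ENNReal.mul_ne_top ENNReal.ofReal_ne_top
    ((tailDensity_le_one _).trans_lt ENNReal.one_lt_top).ne) hle
  rw [ENNReal.toReal_mul, ENNReal.toReal_ofReal (by positivity)] at h2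
  have h3 := Real.log_le_log hL h2
  rw [Real.log_mul (by positivity) hq.ne', Real.log_mul (by positivity) (by positivity),
    Real.log_exp, Real.log_pow] at h3
  push_cast at h3
  exact h3

/-- The tangent of `log` at `P` gives `log (1 + v ^ 2) ≤ log P + (1 + v ^ 2) / P`. Divided by `log P
≥ 1`, this bounds the cost of the weight with `δ = 1 / log P` by a constant per coordinate once `P`
exceeds the order of the mean output energy per coordinate. -/
theorem sum_log_one_add_le {P : ℝ} (hP : 3 ≤ P) (y : Fin n → Fin a → ℂ) :
    1 / Real.log P * ∑ t, ∑ r, Real.log (1 + ‖y t r‖ ^ 2) ≤ n * a + (n * a + energy y) / P := by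
  have hP0 : 0 < P := by linarith
  have hlog : 1 ≤ Real.log P := by
    rw [Real.le_log_iff_exp_le hP0]
    exact Real.exp_one_lt_three.le.trans hP
  have hterm : ∀ t r, 1 / Real.log P * Real.log (1 + ‖y t r‖ ^ 2) ≤ 1 + (1 + ‖y t r‖ ^ 2) / P := by
    intro t r
    have h1 := log_le_log_add_div_sub_one (x := 1 + ‖y t r‖ ^ 2) (by positivity) hP0
    have h2 : 0 ≤ (1 + ‖y t r‖ ^ 2) / P := by positivity
    rw [one_div_mul_eq_div, div_le_iff₀ (by linarith)]
    nlinarith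
  calc _ = ∑ t, ∑ r, 1 / Real.log P * Real.log (1 + ‖y t r‖ ^ 2) := by simp [Finset.mul_sum]
    _ ≤ ∑ t, ∑ r, (1 + (1 + ‖y t r‖ ^ 2) / P) :=
        Finset.sum_le_sum fun t _ => Finset.sum_le_sum fun r _ => hterm t r
    _ = _ := by
        simp only [Finset.sum_add_distrib, ← Finset.sum_div, energy]
        simp

end Pointwise

/-! ### Source, input and signal of an encoder -/

namespace Encoder

variable {k m n : ℕ} {N : Fin (k + 1) → ℕ} (c : Encoder m N n)

instance : IsProbabilityMeasure (uniformOn (Set.univ : Set (Fin c.M))) :=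
  isProbabilityMeasure_uniformOn Set.finite_univ ⟨⟨0, c.M_pos⟩, trivial⟩

/-- The joint law of the message and the private randomness. -/
noncomputable def sourceLaw : Measure (Fin c.M × c.Priv) :=
  (uniformOn (Set.univ : Set (Fin c.M))).prod c.privLaw

instance : IsProbabilityMeasure c.sourceLaw := by
  unfold sourceLaw; infer_instance

/-- The transmitted block as a function of the source and the channel of receiver `0`. -/
def input (s : Fin c.M × c.Priv) (g : Fin n → Fin (N 0) → Fin m → ℂ) (t : Fin n) : Fin m → ℂ :=
  c.enc t s.1 s.2 fun τ => g (Fin.castLE t.isLt.le τ)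

/-- The noiseless block at the first `a` antennas of receiver `j`. -/
def signal (j : Fin (k + 1)) (a : ℕ) (ha : a ≤ N j) (s : Fin c.M × c.Priv) (g : Channels m N n) :
    Fin n → Fin a → ℂ :=
  fun t r => ∑ i, g t j (Fin.castLE ha r) i * c.input s (fun τ => g τ 0) t i

/-- Source, channel coefficients, and the noise at the first `a` antennas of receiver `j`. -/
def observe (j : Fin (k + 1)) (a : ℕ) (ha : a ≤ N j) (ω : c.Sample) :
    (Fin c.M × c.Priv) × Channels m N n × (Fin n → Fin a → ℂ) :=
  ((ω.1, ω.2.1), ω.2.2.1, fun t r => ω.2.2.2 t j (Fin.castLE ha r))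

theorem measurable_input :
    Measurable fun q : (Fin c.M × c.Priv) × (Fin n → Fin (N 0) → Fin m → ℂ) =>
      c.input q.1 q.2 := by
  refine measurable_pi_lambda _ fun t => ?_
  have h1 : Measurable fun q : Fin c.M × c.Priv × (Fin (t : ℕ) → Fin (N 0) → Fin m → ℂ) =>
      c.enc t q.1 q.2.1 q.2.2 :=
    measurable_from_prod_countable_right fun w => c.measurable_enc t w
  have h2 := h1.comp (by fun_prop :
    Measurable fun q : (Fin c.M × c.Priv) × (Fin n → Fin (N 0) → Fin m → ℂ) =>
      (q.1.1, q.1.2, fun τ : Fin (t : ℕ) => q.2 (Fin.castLE t.isLt.le τ)))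
  exact h2

theorem measurable_input_channels :
    Measurable fun q : (Fin c.M × c.Priv) × Channels m N n => c.input q.1 fun t => q.2 t 0 := by
  have h := c.measurable_input.comp (by fun_prop :
    Measurable fun q : (Fin c.M × c.Priv) × Channels m N n => (q.1, fun t => q.2 t 0))
  exact h

theorem measurable_signal (j : Fin (k + 1)) (a : ℕ) (ha : a ≤ N j) :
    Measurable fun q : (Fin c.M × c.Priv) × Channels m N n => c.signal j a ha q.1 q.2 := by
  have h := c.measurable_input_channels
  unfold signal
  fun_prop

variable {dmax F : ℝ} {law : Measure ℂ}

theorem measurePreserving_source_channels [IsProbabilityMeasure law] :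
    MeasurePreserving (fun ω : c.Sample => ((ω.1, ω.2.1), ω.2.2)) (c.measure law)
      (c.sourceLaw.prod ((channelMeasure m N n law).prod (noiseMeasure N n))) :=
  (measurePreserving_prodAssoc _ _ _).symm

theorem measurePreserving_observe [IsProbabilityMeasure law] (j : Fin (k + 1)) (a : ℕ)
    (ha : a ≤ N j) :
    MeasurePreserving (c.observe j a ha) (c.measure law)
      (c.sourceLaw.prod ((channelMeasure m N n law).prod (blockNoise n a))) := by
  have h1 : MeasurePreserving (fun (z : Noises N n) t (r : Fin a) => z t j (Fin.castLE ha r))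
      (noiseMeasure N n) (blockNoise n a) := ⟨by fun_prop, noiseMeasure_map j ha⟩
  exact ((MeasurePreserving.id c.sourceLaw).prod
    ((MeasurePreserving.id (channelMeasure m N n law)).prod h1)).comp
    c.measurePreserving_source_channels

theorem energy_signal_le {j : Fin (k + 1)} {a : ℕ} {ha : a ≤ N j} {s : Fin c.M × c.Priv}
    {g : Channels m N n} (hg : ∀ t j r i, ‖g t j r i‖ ≤ dmax) :
    energy (c.signal j a ha s g) ≤ a * (m * dmax) ^ 2 *
      ∑ t, ∑ i, ‖c.input s (fun τ => g τ 0) t i‖ ^ 2 := by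
  have hslot : ∀ t r, ‖c.signal j a ha s g t r‖ ^ 2 ≤
      (m * dmax) ^ 2 * ∑ i, ‖c.input s (fun τ => g τ 0) t i‖ ^ 2 := by
    intro t r
    have h1 : ‖c.signal j a ha s g t r‖ ≤ dmax * ∑ i, ‖c.input s (fun τ => g τ 0) t i‖ := by
      rw [Finset.mul_sum]
      refine norm_sum_le_of_le _ fun i _ => ?_
      rw [norm_mul]
      exact mul_le_mul_of_nonneg_right (hg _ _ _ _) (norm_nonneg _)
    have h2 : (∑ i, ‖c.input s (fun τ => g τ 0) t i‖) ^ 2 ≤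
        m * ∑ i, ‖c.input s (fun τ => g τ 0) t i‖ ^ 2 := by
      simpa using sq_sum_le_card_mul_sum_sq (s := Finset.univ)
        (f := fun i => ‖c.input s (fun τ => g τ 0) t i‖)
    -- Cauchy-Schwarz gives a factor `m`; enlarging it to `m ^ 2` produces the same constant `m *
    -- dmax` as in the Lipschitz bound `norm_signal_sub_le`.
    have h3 : (m : ℝ) ≤ m ^ 2 := by exact_mod_cast Nat.le_self_pow two_ne_zero m
    calc _ ≤ (dmax * ∑ i, ‖c.input s (fun τ => g τ 0) t i‖) ^ 2 :=
          pow_le_pow_left₀ (norm_nonneg _) h1 2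
      _ = dmax ^ 2 * (∑ i, ‖c.input s (fun τ => g τ 0) t i‖) ^ 2 := by ring
      _ ≤ dmax ^ 2 * (m ^ 2 * ∑ i, ‖c.input s (fun τ => g τ 0) t i‖ ^ 2) := by
          gcongr
          exact h2.trans (by gcongr)
      _ = _ := by ring
  calc energy (c.signal j a ha s g)
      ≤ ∑ t, ∑ _r : Fin a, (m * dmax) ^ 2 * ∑ i, ‖c.input s (fun τ => g τ 0) t i‖ ^ 2 :=
        Finset.sum_le_sum fun t _ => Finset.sum_le_sum fun r _ => hslot t r
    _ = _ := by simp [Finset.mul_sum, mul_assoc]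

theorem norm_signal_sub_le {j : Fin (k + 1)} {a : ℕ} {ha : a ≤ N j} {s s' : Fin c.M × c.Priv}
    {g : Channels m N n} (hg : ∀ t j r i, ‖g t j r i‖ ≤ dmax) (t : Fin n) (r : Fin a) :
    ‖c.signal j a ha s g t r - c.signal j a ha s' g t r‖ ≤
      m * dmax * ‖c.input s (fun τ => g τ 0) t - c.input s' (fun τ => g τ 0) t‖ := by
  have h1 : c.signal j a ha s g t r - c.signal j a ha s' g t r = ∑ i, g t j (Fin.castLE ha r) i *
      (c.input s (fun τ => g τ 0) t - c.input s' (fun τ => g τ 0) t) i := by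
    simp [signal, mul_sub]
  rw [h1]
  calc _ ≤ ∑ _i : Fin m,
        dmax * ‖c.input s (fun τ => g τ 0) t - c.input s' (fun τ => g τ 0) t‖ := by
        refine norm_sum_le_of_le _ fun i _ => ?_
        rw [norm_mul]
        exact mul_le_mul (hg _ _ _ _) (norm_le_pi_norm _ i) (norm_nonneg _)
          ((norm_nonneg _).trans (hg t j (Fin.castLE ha r) i))
    _ = _ := by simp [mul_assoc]

theorem lintegral_energy_signal_le (h : IsChannelLaw dmax F law) {p : ℝ}
    (hc : c.PowerConstraint law p) (j : Fin (k + 1)) (a : ℕ) (ha : a ≤ N j) :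
    ∫⁻ q, ENNReal.ofReal (energy (c.signal j a ha q.1 q.2))
        ∂(c.sourceLaw.prod (channelMeasure m N n law)) ≤
      ENNReal.ofReal (a * (m * dmax) ^ 2 * (n * p)) := by
  have := h.isProbabilityMeasure
  have hbound : ∀ᵐ q ∂(c.sourceLaw.prod (channelMeasure m N n law)),
      ∀ t j r i, ‖q.2 t j r i‖ ≤ dmax :=
    Measure.quasiMeasurePreserving_snd.ae (ae_norm_channel_le h)
  have hmp : MeasurePreserving (fun ω : c.Sample => ((ω.1, ω.2.1), ω.2.2.1)) (c.measure law)
      (c.sourceLaw.prod (channelMeasure m N n law)) :=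
    ((MeasurePreserving.id c.sourceLaw).prod measurePreserving_fst).comp
      c.measurePreserving_source_channels
  have hin := c.measurable_input_channels
  have hpow : ∫⁻ q, ∑ t, ∑ i, ‖c.input q.1 (fun τ => q.2 τ 0) t i‖ₑ ^ 2
      ∂(c.sourceLaw.prod (channelMeasure m N n law)) ≤ n * ENNReal.ofReal p := by
    rw [← hmp.lintegral_comp (by fun_prop)]
    exact hc
  calc _ ≤ ∫⁻ q, ENNReal.ofReal (a * (m * dmax) ^ 2) *
          ∑ t, ∑ i, ‖c.input q.1 (fun τ => q.2 τ 0) t i‖ₑ ^ 2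
          ∂(c.sourceLaw.prod (channelMeasure m N n law)) := by
        refine lintegral_mono_ae ?_
        filter_upwards [hbound] with q hq
        refine (ENNReal.ofReal_le_ofReal (c.energy_signal_le hq)).trans_eq ?_
        rw [ENNReal.ofReal_mul (by positivity), ENNReal.ofReal_sum_of_nonneg fun i _ => by positivity]
        congr 1
        refine Finset.sum_congr rfl fun t _ => ?_
        rw [ENNReal.ofReal_sum_of_nonneg fun i _ => by positivity]
        refine Finset.sum_congr rfl fun i _ => ?_
        rw [ENNReal.ofReal_pow (norm_nonneg _), ofReal_norm]
    _ ≤ ENNReal.ofReal (a * (m * dmax) ^ 2) * (n * ENNReal.ofReal p) := by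
        rw [lintegral_const_mul _ (by fun_prop)]
        gcongr
    _ = _ := by
        rw [ENNReal.ofReal_mul (p := a * (m * dmax) ^ 2) (by positivity),
          ENNReal.ofReal_mul (by positivity : (0 : ℝ) ≤ n), ENNReal.ofReal_natCast]

end Encoder

theorem integrable_and_integral_le_of_lintegral_le {Ω : Type*} [MeasurableSpace Ω] {μ : Measure Ω}
    {f : Ω → ℝ} (hf : AEStronglyMeasurable f μ) (h0 : ∀ ω, 0 ≤ f ω) {C : ℝ} (hC : 0 ≤ C)
    (h : ∫⁻ ω, ENNReal.ofReal (f ω) ∂μ ≤ ENNReal.ofReal C) : Integrable f μ ∧ ∫ ω, f ω ∂μ ≤ C := by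
  refine ⟨⟨hf, ?_⟩, ?_⟩
  · rw [hasFiniteIntegral_iff_ofReal (Filter.Eventually.of_forall h0)]
    exact h.trans_lt ENNReal.ofReal_lt_top
  · rw [integral_eq_lintegral_of_nonneg_ae (Filter.Eventually.of_forall h0) hf]
    exact ENNReal.toReal_le_of_le_ofReal hC h

theorem integrable_and_integral_toReal_le_one {Ω : Type*} [MeasurableSpace Ω] {μ : Measure Ω}
    {f : Ω → ℝ≥0∞} (hf : Measurable f) (h : ∫⁻ ω, f ω ∂μ ≤ 1) :
    Integrable (fun ω => (f ω).toReal) μ ∧ ∫ ω, (f ω).toReal ∂μ ≤ 1 :=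
  integrable_and_integral_le_of_lintegral_le hf.ennreal_toReal.aestronglyMeasurable
    (fun _ => ENNReal.toReal_nonneg) zero_le_one
    ((lintegral_mono fun _ => ENNReal.ofReal_toReal_le).trans (by simpa using h))

/-! ### The two output densities and their comparison -/

namespace Encoder

variable {k m n : ℕ} {N : Fin (k + 1) → ℕ} (c : Encoder m N n) {dmax F : ℝ} {law : Measure ℂ}

/-- The density of the block received by the first `a` antennas of receiver `j`, at the received
block. -/
noncomputable def outputDensity (j : Fin (k + 1)) (a : ℕ) (ha : a ≤ N j) (ω : c.Sample) : ℝ≥0∞ :=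
  outDensity c.sourceLaw (c.signal j a ha) (c.G ω, c.YFirst j a ha ω)

/-- The ratio of the density of the received block to its bound by alignment. -/
noncomputable def alignmentRatio (F : ℝ) (j : Fin (k + 1)) (a : ℕ) (ha : a ≤ N j) (ω : c.Sample) :
    ℝ≥0∞ :=
  c.outputDensity j a ha ω / spread c.sourceLaw c.input F a (ω.1, ω.2.1) fun t => c.G ω t 0

theorem measurable_G_YFirst (j : Fin (k + 1)) (a : ℕ) (ha : a ≤ N j) :
    Measurable fun ω : c.Sample => (c.G ω, c.YFirst j a ha ω) := by
  have h := (c.measurable_signal j a ha).comp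
    (by fun_prop : Measurable fun ω : c.Sample => ((ω.1, ω.2.1), ω.2.2.1))
  have hG : Measurable c.G := by unfold G; fun_prop
  have hY : Measurable (c.YFirst j a ha) :=
    h.add (by fun_prop : Measurable fun (ω : c.Sample) t (r : Fin a) =>
      ω.2.2.2 t j (Fin.castLE ha r))
  exact hG.prodMk hY

theorem measurable_outputDensity (j : Fin (k + 1)) (a : ℕ) (ha : a ≤ N j) :
    Measurable (c.outputDensity j a ha) :=
  (measurable_outDensity (c.measurable_signal j a ha)).comp (c.measurable_G_YFirst j a ha)

theorem measurable_sample_spread (F : ℝ) (a : ℕ) :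
    Measurable fun q : (Fin c.M × c.Priv) × Channels m N n =>
      spread c.sourceLaw c.input F a q.1 fun t => q.2 t 0 := by
  have h := (measurable_spread (ρ := c.sourceLaw) c.measurable_input F a).comp
    (by fun_prop : Measurable fun q : (Fin c.M × c.Priv) × Channels m N n =>
      (q.1, fun t => q.2 t 0))
  exact h

theorem measurable_alignmentRatio (F : ℝ) (j : Fin (k + 1)) (a : ℕ) (ha : a ≤ N j) :
    Measurable (c.alignmentRatio F j a ha) := by
  have h := (c.measurable_sample_spread F a).comp
    (by fun_prop : Measurable fun ω : c.Sample => ((ω.1, ω.2.1), ω.2.2.1))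
  exact (c.measurable_outputDensity j a ha).div h

/-- For a fixed source, the ratio depends on the channels only through those of receiver `0` and the
first `a` rows of receiver `j`, which are independent since `j ≠ 0`; then `lintegral_div_spread_le`
applies. -/
theorem lintegral_alignmentRatio_le (h : IsChannelLaw dmax F law) {j : Fin (k + 1)} (hj : 0 ≠ j)
    (a : ℕ) (ha : a ≤ N j) : ∫⁻ ω, c.alignmentRatio F j a ha ω ∂(c.measure law) ≤ 1 := by
  have := h.isProbabilityMeasure
  have hA := c.measurable_signal j a ha
  have hA' : Measurable fun q : (Fin c.M × c.Priv) × Channels m N n × (Fin n → Fin a → ℂ) =>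
      c.signal j a ha q.1 q.2.1 := by
    have h1 := hA.comp (by fun_prop :
      Measurable fun q : (Fin c.M × c.Priv) × Channels m N n × (Fin n → Fin a → ℂ) => (q.1, q.2.1))
    exact h1
  have hf : Measurable fun q : (Fin c.M × c.Priv) × Channels m N n × (Fin n → Fin a → ℂ) =>
      outDensity c.sourceLaw (c.signal j a ha) (q.2.1, c.signal j a ha q.1 q.2.1 + q.2.2) /
        spread c.sourceLaw c.input F a q.1 fun t => q.2.1 t 0 := by
    have h1 := (measurable_outDensity (ρ := c.sourceLaw) hA).comp (by fun_prop :
      Measurable fun q : (Fin c.M × c.Priv) × Channels m N n × (Fin n → Fin a → ℂ) =>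
        (q.2.1, c.signal j a ha q.1 q.2.1 + q.2.2))
    have h2 := (c.measurable_sample_spread F a).comp (by fun_prop :
      Measurable fun q : (Fin c.M × c.Priv) × Channels m N n × (Fin n → Fin a → ℂ) => (q.1, q.2.1))
    exact h1.div h2
  have h1 := (c.measurePreserving_observe (law := law) j a ha).lintegral_comp hf
  refine (Eq.trans_le h1 ?_ : ∫⁻ ω, c.alignmentRatio F j a ha ω ∂(c.measure law) ≤ 1)
  rw [lintegral_prod _ hf.aemeasurable]
  calc _ ≤ ∫⁻ _, 1 ∂c.sourceLaw := by
        refine lintegral_mono fun s => ?_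
        have hfs := hf.comp (measurable_prodMk_left (x := s))
        simp only [Function.comp_def] at hfs
        rw [lintegral_prod _ hfs.aemeasurable]
        have h2 := lintegral_map (measurable_div_spread (ρ := c.sourceLaw) c.measurable_input F a s)
          (by fun_prop : Measurable fun g : Channels m N n =>
            (fun t => g t 0, fun t (r : Fin a) => g t j (Fin.castLE ha r)))
          (μ := channelMeasure m N n law)
        rw [channelMeasure_map_pair hj ha] at h2
        refine Eq.trans_le ?_ (h2.symm.trans_le
          (lintegral_div_spread_le h c.measurable_input a s))
        refine lintegral_congr fun g => lintegral_congr fun z => ?_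
        congr 1
        refine lintegral_congr fun s' => ?_
        congr 1
        ext t r
        simp [signal, mul_sub]
        ring
    _ = 1 := by simp

/-- All the comparisons are chained at one sample point: eavesdropper density, `spread` with
exponent `a`, `spread` with exponent `N 0`, heavy-tailed density, density at receiver `0`. Only the
two ratios and the energies remain as random errors. -/
theorem log_outputDensity_le {j : Fin (k + 1)} {a : ℕ} (ha0 : 0 < a) (ha : a ≤ N j)
    (ha' : a ≤ N 0) (hF : 0 < F) {P : ℝ} (hP : 3 ≤ P) {ω : c.Sample}
    (hω : ∀ t j r i, ‖c.G ω t j r i‖ ≤ dmax) :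
    (N 0 : ℝ) / a * Real.log (c.outputDensity j a ha ω).toReal ≤
      Real.log (c.outputDensity 0 (N 0) le_rfl ω).toReal +
      (N 0 : ℝ) / a * ((c.alignmentRatio F j a ha ω).toReal - 1) +
      ((tailRatio c.sourceLaw (c.signal 0 (N 0) le_rfl) (1 / Real.log P)
        (c.G ω, c.YFirst 0 (N 0) le_rfl ω)).toReal - 1) +
      n * N 0 * (Real.log (2 * (1 + F) * (1 + (m * dmax) ^ 2)) +
        Real.log (2 * Real.pi * Real.log P) + 1 + 1 / P) +
      (1 + 2 / P) * energy (ω.2.2.2 · 0) +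
      2 / P * energy (c.signal 0 (N 0) le_rfl (ω.1, ω.2.1) (c.G ω)) := by
  have hP0 : 0 < P := by linarith
  have hlog : 0 < Real.log P := Real.log_pos (by linarith)
  set s : Fin c.M × c.Priv := (ω.1, ω.2.1) with hs
  set g₀ : Fin n → Fin (N 0) → Fin m → ℂ := fun t => c.G ω t 0 with hg₀
  set z : Fin n → Fin (N 0) → ℂ := fun t => ω.2.2.2 t 0 with hz
  have hY : c.YFirst 0 (N 0) le_rfl ω = c.signal 0 (N 0) le_rfl s (c.G ω) + z := rfl
  have hL : 0 < (spread c.sourceLaw c.input F a s g₀).toReal :=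
    ENNReal.toReal_pos (spread_pos c.measurable_input hF a s g₀).ne' (spread_lt_top hF a s g₀).ne
  have hf2 : 0 < (c.outputDensity j a ha ω).toReal :=
    outDensity_toReal_pos (c.measurable_signal j a ha) _
  have h1 := log_le_log_add_div_sub_one hf2 hL
  rw [← ENNReal.toReal_div] at h1
  have h2 := mul_log_spread_le (ρ := c.sourceLaw) c.measurable_input hF ha0 ha' s g₀
  have h3 := log_spread_le (ρ := c.sourceLaw) c.measurable_input
    (c.measurable_signal 0 (N 0) le_rfl) hF (s := s) (g₀ := g₀) (g := c.G ω) (c := m * dmax)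
    (fun s' t r => c.norm_signal_sub_le hω t r) z
  have h4 := log_tailDensity_le (ρ := c.sourceLaw) (c.measurable_signal 0 (N 0) le_rfl)
    (δ := 1 / Real.log P) (by positivity) (c.G ω, c.signal 0 (N 0) le_rfl s (c.G ω) + z)
  have h5 := sum_log_one_add_le hP (c.signal 0 (N 0) le_rfl s (c.G ω) + z)
  have h6 := energy_add_le (c.signal 0 (N 0) le_rfl s (c.G ω)) z
  have h7 : (N 0 : ℝ) / a * Real.log (c.outputDensity j a ha ω).toReal ≤
      (N 0 : ℝ) / a * Real.log (spread c.sourceLaw c.input F a s g₀).toReal +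
      (N 0 : ℝ) / a * ((c.alignmentRatio F j a ha ω).toReal - 1) := by
    rw [← mul_add]
    exact mul_le_mul_of_nonneg_left h1 (by positivity)
  have h8 : (n * N 0 + energy (c.signal 0 (N 0) le_rfl s (c.G ω) + z)) / P ≤
      n * N 0 * (1 / P) + 2 / P * energy (c.signal 0 (N 0) le_rfl s (c.G ω)) +
        2 / P * energy z := by
    rw [div_le_iff₀ hP0]
    have e : (n * N 0 * (1 / P) + 2 / P * energy (c.signal 0 (N 0) le_rfl s (c.G ω)) +
        2 / P * energy z) * P =
        n * N 0 + 2 * energy (c.signal 0 (N 0) le_rfl s (c.G ω)) + 2 * energy z := by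
      field_simp
    rw [e]
    linarith
  have h9 : 2 * Real.pi / (1 / Real.log P) = 2 * Real.pi * Real.log P := by
    field_simp
  rw [h9] at h4
  rw [hY]
  simp only [outputDensity, hY] at h7 ⊢
  dsimp only at h4
  linarith

theorem integral_log_outputDensity_le {j : Fin (k + 1)} (hj : 0 ≠ j) {a : ℕ} (ha0 : 0 < a)
    (ha : a ≤ N j) (ha' : a ≤ N 0) (h : IsChannelLaw dmax F law) {p : ℝ} (hp : 0 < p)
    (hc : c.PowerConstraint law p)
    (hint : Integrable (fun ω => Real.log (c.outputDensity j a ha ω).toReal) (c.measure law))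
    (hint₀ : Integrable (fun ω => Real.log (c.outputDensity 0 (N 0) le_rfl ω).toReal)
      (c.measure law)) :
    (N 0 : ℝ) / a * ∫ ω, Real.log (c.outputDensity j a ha ω).toReal ∂(c.measure law) ≤
      ∫ ω, Real.log (c.outputDensity 0 (N 0) le_rfl ω).toReal ∂(c.measure law) +
      n * (N 0 * (Real.log (2 * (1 + F) * (1 + (m * dmax) ^ 2)) +
        Real.log (2 * Real.pi * Real.log (3 + 2 * (m * dmax) ^ 2 * p)) + 3)) := by
  have := h.isProbabilityMeasure
  have : IsProbabilityMeasure (c.measure law) := by unfold measure; infer_instance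
  have hmp := c.measurePreserving_observe (law := law) 0 (N 0) le_rfl
  have hA := c.measurable_signal 0 (N 0) le_rfl
  -- This makes `1 / P + 2 / P + 2 / P * ((m * dmax) ^ 2 * p)` equal to `1`. Together with the
  -- constant `1` from the weight and the `1` from the noise energy it yields the `3` in the bound.
  set P : ℝ := 3 + 2 * (m * dmax) ^ 2 * p with hPdef
  have hP : 3 ≤ P := by
    have : 0 ≤ 2 * (m * dmax) ^ 2 * p := by positivity
    linarith
  have hP0 : 0 < P := by linarith
  have hlog : 0 < Real.log P := Real.log_pos (by linarith)
  obtain ⟨hR2, hR2'⟩ := integrable_and_integral_toReal_le_one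
    (c.measurable_alignmentRatio F j a ha) (c.lintegral_alignmentRatio_le h hj a ha)
  have hTm := measurable_tailRatio (ρ := c.sourceLaw) hA (1 / Real.log P)
  obtain ⟨hR1, hR1'⟩ := integrable_and_integral_toReal_le_one (μ := c.measure law)
    (f := fun ω => tailRatio c.sourceLaw (c.signal 0 (N 0) le_rfl) (1 / Real.log P)
      (c.G ω, c.YFirst 0 (N 0) le_rfl ω)) (hTm.comp (c.measurable_G_YFirst 0 (N 0) le_rfl)) (by
    have hA' : Measurable fun q : (Fin c.M × c.Priv) × Channels m N n ×
        (Fin n → Fin (N 0) → ℂ) => c.signal 0 (N 0) le_rfl q.1 q.2.1 := by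
      have h1 := hA.comp (by fun_prop : Measurable fun q : (Fin c.M × c.Priv) × Channels m N n ×
        (Fin n → Fin (N 0) → ℂ) => (q.1, q.2.1))
      exact h1
    have h1 := hmp.lintegral_comp (hTm.comp (by fun_prop : Measurable
      fun q : (Fin c.M × c.Priv) × Channels m N n × (Fin n → Fin (N 0) → ℂ) =>
        (q.2.1, c.signal 0 (N 0) le_rfl q.1 q.2.1 + q.2.2)))
    exact h1.trans_le (lintegral_tailRatio_le hA (by positivity)))
  have hmp1 : MeasurePreserving (fun ω : c.Sample => ((ω.1, ω.2.1), c.G ω)) (c.measure law)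
      (c.sourceLaw.prod (channelMeasure m N n law)) :=
    ((MeasurePreserving.id c.sourceLaw).prod measurePreserving_fst).comp
      c.measurePreserving_source_channels
  have hmp2 : MeasurePreserving (fun ω : c.Sample => (ω.2.2.2 · 0)) (c.measure law)
      (blockNoise n (N 0)) :=
    (measurePreserving_snd.comp measurePreserving_snd).comp hmp
  obtain ⟨hE1, hE1'⟩ := integrable_and_integral_le_of_lintegral_le (μ := c.measure law)
    (f := fun ω => energy (ω.2.2.2 · 0)) (C := n * N 0)
    (measurable_energy.comp hmp2.measurable).aestronglyMeasurable
    (fun _ => energy_nonneg _) (by positivity) (by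
      have h1 := hmp2.lintegral_comp (f := fun z => ENNReal.ofReal (energy z)) (by fun_prop)
      rw [h1, lintegral_energy_noise, ENNReal.ofReal_mul (by positivity)]
      simp)
  obtain ⟨hE2, hE2'⟩ := integrable_and_integral_le_of_lintegral_le (μ := c.measure law)
    (f := fun ω => energy (c.signal 0 (N 0) le_rfl (ω.1, ω.2.1) (c.G ω)))
    (C := N 0 * (m * dmax) ^ 2 * (n * p))
    ((measurable_energy.comp hA).comp hmp1.measurable).aestronglyMeasurable
    (fun _ => energy_nonneg _) (by positivity) (by
      have h1 := hmp1.lintegral_comp (f := fun q => ENNReal.ofReal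
        (energy (c.signal 0 (N 0) le_rfl q.1 q.2))) (by fun_prop)
      rw [h1]
      exact c.lintegral_energy_signal_le h hc 0 (N 0) le_rfl)
  have hbound : ∀ᵐ ω ∂(c.measure law), ∀ t j r i, ‖c.G ω t j r i‖ ≤ dmax :=
    (Measure.quasiMeasurePreserving_snd.comp hmp1.quasiMeasurePreserving).ae (ae_norm_channel_le h)
  have hpt := hbound.mono fun ω hω => c.log_outputDensity_le ha0 ha ha' h.pos hP hω
  have hI2 := (hR2.sub (integrable_const 1)).const_mul ((N 0 : ℝ) / a)
  have hI3 := hR1.sub (integrable_const (1 : ℝ))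
  have hI12 := hint₀.add hI2
  have hI13 := hI12.add hI3
  have hI4 := hI13.add (integrable_const (n * N 0 * (Real.log (2 * (1 + F) * (1 + (m * dmax) ^ 2)) +
        Real.log (2 * Real.pi * Real.log P) + 1 + 1 / P)))
  have hI5 := hI4.add (hE1.const_mul (1 + 2 / P))
  have hI6 := hI5.add (hE2.const_mul (2 / P))
  have hmono := integral_mono_ae (hint.const_mul ((N 0 : ℝ) / a)) hI6 hpt
  rw [integral_const_mul, integral_add' hI5 (hE2.const_mul _), integral_add' hI4 (hE1.const_mul _),
    integral_add' hI13 (integrable_const _), integral_add' hI12 hI3, integral_add' hint₀ hI2,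
    integral_const_mul, integral_const_mul, integral_const_mul (1 + 2 / P),
    integral_const_mul (2 / P),
    integral_sub' hR1 (integrable_const _), integral_sub' hR2 (integrable_const _)] at hmono
  simp only [integral_const, probReal_univ, smul_eq_mul, one_mul] at hmono
  have hb1 : (N 0 : ℝ) / a * (∫ ω, (c.alignmentRatio F j a ha ω).toReal ∂(c.measure law) - 1) ≤ 0 :=
    mul_nonpos_of_nonneg_of_nonpos (by positivity) (by linarith)
  have hb2 := mul_le_mul_of_nonneg_left hE1' (by positivity : 0 ≤ 1 + 2 / P)
  have hb3 := mul_le_mul_of_nonneg_left hE2' (by positivity : 0 ≤ 2 / P)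
  have hPP : 1 / P + 2 / P + 2 / P * ((m * dmax) ^ 2 * p) = 1 := by
    field_simp
    rw [hPdef]; ring
  have hsum : (n : ℝ) * N 0 * (1 / P + 2 / P + 2 / P * ((m * dmax) ^ 2 * p)) = n * N 0 := by
    rw [hPP, mul_one]
  linarith

theorem hasCondDiffEntropy_YFirst (h : IsChannelLaw dmax F law) {p : ℝ}
    (hc : c.PowerConstraint law p) (j : Fin (k + 1)) (a : ℕ) (ha : a ≤ N j) :
    HasCondDiffEntropy (c.measure law) (c.YFirst j a ha) c.G := by
  have := h.isProbabilityMeasure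
  have h1 := hasCondDiffEntropy_additive (c.measurable_signal j a ha)
    (c.measurePreserving_observe (law := law) j a ha)
    ((c.lintegral_energy_signal_le h hc j a ha).trans_lt ENNReal.ofReal_lt_top).ne
  exact h1

theorem integrable_log_outputDensity (h : IsChannelLaw dmax F law) {p : ℝ}
    (hc : c.PowerConstraint law p) (j : Fin (k + 1)) (a : ℕ) (ha : a ≤ N j) :
    Integrable (fun ω => Real.log (c.outputDensity j a ha ω).toReal) (c.measure law) := by
  have := h.isProbabilityMeasure
  have h1 := (c.measurePreserving_observe (law := law) j a ha).integrable_comp_of_integrable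
    (integrable_log_outDensity (c.measurable_signal j a ha)
      ((c.lintegral_energy_signal_le h hc j a ha).trans_lt ENNReal.ofReal_lt_top).ne)
  exact h1

theorem condDiffEntropy_YFirst [IsProbabilityMeasure law] (j : Fin (k + 1)) (a : ℕ)
    (ha : a ≤ N j) :
    condDiffEntropy (c.measure law) (c.YFirst j a ha) c.G =
      -∫ ω, Real.log (c.outputDensity j a ha ω).toReal ∂(c.measure law) := by
  have h1 := condDiffEntropy_additive (c.measurable_signal j a ha)
    (c.measurePreserving_observe (law := law) j a ha)
  exact h1

theorem condDiffEntropy_Y_zero_le {j : Fin (k + 1)} (hj : 0 ≠ j) {a : ℕ} (ha0 : 0 < a)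
    (ha : a ≤ N j) (ha' : a ≤ N 0) (h : IsChannelLaw dmax F law) {p : ℝ} (hp : 0 < p)
    (hc : c.PowerConstraint law p) :
    condDiffEntropy (c.measure law) (c.Y 0) c.G ≤
      (N 0 : ℝ) / a * condDiffEntropy (c.measure law) (c.YFirst j a ha) c.G +
      n * (N 0 * (F + (m * dmax) ^ 2 + 4 +
        Real.log (2 * Real.pi * Real.log (3 + 2 * (m * dmax) ^ 2 * p)))) := by
  have := h.isProbabilityMeasure
  have hmain := c.integral_log_outputDensity_le hj ha0 ha ha' h hp hc
    (c.integrable_log_outputDensity h hc j a ha)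
    (c.integrable_log_outputDensity h hc 0 (N 0) le_rfl)
  have hF := h.pos
  -- Bounding `log (1 + F)` by `F` makes the error linear in `F`, which suffices because `fmax` is
  -- assumed to be `o(log p)`.
  have hlogK : Real.log (2 * (1 + F) * (1 + (m * dmax) ^ 2)) ≤ F + (m * dmax) ^ 2 + 1 := by
    rw [Real.log_mul (by positivity) (by positivity),
      Real.log_mul (by norm_num) (by positivity)]
    have h1 := Real.log_le_sub_one_of_pos (by norm_num : (0 : ℝ) < 2)
    have h2 := Real.log_le_sub_one_of_pos (by positivity : 0 < 1 + F)
    have h3 := Real.log_le_sub_one_of_pos (by positivity : (0 : ℝ) < 1 + (m * dmax) ^ 2)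
    linarith
  have hstep : (n : ℝ) * (N 0 * (Real.log (2 * (1 + F) * (1 + (m * dmax) ^ 2)) +
      Real.log (2 * Real.pi * Real.log (3 + 2 * (m * dmax) ^ 2 * p)) + 3)) ≤
      n * (N 0 * (F + (m * dmax) ^ 2 + 4 +
        Real.log (2 * Real.pi * Real.log (3 + 2 * (m * dmax) ^ 2 * p)))) := by
    refine mul_le_mul_of_nonneg_left (mul_le_mul_of_nonneg_left ?_ (Nat.cast_nonneg _))
      (Nat.cast_nonneg _)
    linarith
  -- The embedding of the first `N 0` antennas into `N 0` antennas is definitionally the identity.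
  have hY : c.Y 0 = c.YFirst 0 (N 0) le_rfl := rfl
  rw [hY, condDiffEntropy_YFirst, condDiffEntropy_YFirst]
  linarith

end Encoder

/-! ### Growth of the error term -/

theorem isLittleO_log_log {b : ℝ} (hb : 0 ≤ b) :
    (fun p => Real.log (2 * Real.pi * Real.log (3 + b * p))) =o[Filter.atTop] Real.log := by
  have hpi : 0 < 4 * Real.pi := by positivity
  have h1 : (fun p => Real.log (4 * Real.pi * Real.log p)) =o[Filter.atTop] Real.log := by
    have h2 := Real.isLittleO_log_id_atTop.comp_tendsto
      (Real.tendsto_log_atTop.const_mul_atTop hpi)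
    exact h2.of_const_mul_right
  refine Asymptotics.IsBigO.trans_isLittleO (Asymptotics.IsBigO.of_bound 1 ?_) h1
  filter_upwards [Filter.eventually_ge_atTop (3 + b)] with p hp
  have hp3 : 3 ≤ p := by linarith
  have hbp : 0 ≤ b * p := by positivity
  have hlow : 1 ≤ Real.log (3 + b * p) := by
    rw [Real.le_log_iff_exp_le (by positivity)]
    linarith [Real.exp_one_lt_three]
  -- For `p ≥ 3 + b` the argument is at most `p ^ 2`, so the dependence on `b` costs only a factor
  -- `2` inside the outer logarithm.
  have hup : Real.log (3 + b * p) ≤ 2 * Real.log p := by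
    have h2 : 3 + b * p ≤ p ^ 2 := by nlinarith
    have h3 := Real.log_le_log (by positivity) h2
    rwa [Real.log_pow, Nat.cast_ofNat] at h3
  have hge : 1 ≤ 2 * Real.pi * Real.log (3 + b * p) := by
    nlinarith [Real.pi_gt_three]
  have hle : 2 * Real.pi * Real.log (3 + b * p) ≤ 4 * Real.pi * Real.log p := by
    nlinarith [Real.pi_gt_three]
  rw [one_mul, Real.norm_of_nonneg (Real.log_nonneg hge),
    Real.norm_of_nonneg (Real.log_nonneg (hge.trans hle))]
  exact Real.log_le_log (by linarith) hle

theorem isLittleO_error (a c : ℝ) {fmax : ℝ → ℝ} (hfmax : fmax =o[Filter.atTop] Real.log) :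
    (fun p => a * (fmax p + c ^ 2 + 4 +
      Real.log (2 * Real.pi * Real.log (3 + 2 * c ^ 2 * p)))) =o[Filter.atTop] Real.log := by
  have hconst : ∀ C : ℝ, (fun _ : ℝ => C) =o[Filter.atTop] Real.log := fun C =>
    Real.isLittleO_const_log_atTop
  exact ((((hfmax.add (hconst _)).add (hconst _)).add
    (isLittleO_log_log (by positivity))).const_mul_left a)

end Wiretap

theorem mainTheorem4 {k : ℕ} (m : ℕ) (N : Fin (k + 1) → ℕ) (hN : ∀ j, 0 < N j)
    (hm : max (N 0) (Wiretap.nMax N) < m)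
    (e : Fin k) (he : N e.succ = Wiretap.nMax N)
    (dmax : ℝ) (fmax : ℝ → ℝ) (hfmax : fmax =o[Filter.atTop] Real.log) :
    ∃ ε : ℝ → ℝ, ε =o[Filter.atTop] Real.log ∧
      ∀ (p : ℝ), 0 < p →
      ∀ (law : Measure ℂ), Wiretap.IsChannelLaw dmax (fmax p) law →
      ∀ (n : ℕ), 0 < n →
      ∀ (c : Wiretap.Encoder m N n), c.PowerConstraint law p →
        Wiretap.HasCondDiffEntropy (c.measure law) (c.Y 0) c.G ∧
        Wiretap.HasCondDiffEntropy (c.measure law)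
          (c.YFirst e.succ (Wiretap.nBar N) (Wiretap.nBar_le he)) c.G ∧
        Wiretap.condDiffEntropy (c.measure law) (c.Y 0) c.G ≤
          (N 0 : ℝ) / (Wiretap.nBar N : ℝ) *
            Wiretap.condDiffEntropy (c.measure law)
              (c.YFirst e.succ (Wiretap.nBar N) (Wiretap.nBar_le he)) c.G
          + (n : ℝ) * ε p := by
  refine ⟨fun p => N 0 * (fmax p + (m * dmax) ^ 2 + 4 +
    Real.log (2 * Real.pi * Real.log (3 + 2 * (m * dmax) ^ 2 * p))),
    Wiretap.isLittleO_error _ _ hfmax, fun p hp law hlaw n _ c hc => ⟨?_, ?_, ?_⟩⟩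
  · exact c.hasCondDiffEntropy_YFirst hlaw hc 0 (N 0) le_rfl
  · exact c.hasCondDiffEntropy_YFirst hlaw hc _ _ _
  · exact c.condDiffEntropy_Y_zero_le (Fin.succ_ne_zero e).symm (lt_min (hN 0) (he ▸ hN e.succ))
      (Wiretap.nBar_le he) (min_le_left _ _) hlaw hp hc
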